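/- Let $\mathfrak g$ be a finite-dimensional complex simple Lie algebra, $\mathfrak h$ a Cartan subalgebra, $\alpha_1,\dots,\alpha_l$ the simple roots for a choice of positive roots $\Delta_+$, $H_i\in\mathfrak h$ the coroot of $\alpha_i$, $a_{ij}=\alpha_j(H_i)$ the Cartan matrix, $d_1,\dots,d_l$ the coprime positive integers with $b_{ij}=d_ia_{ij}$ symmetric, and $(\cdot,\cdot)$ the bilinear form on $\mathfrak h^*$ with $(\alpha_i,\alpha_j)=b_{ij}$. Put $q=e^h$, $q_i=q^{d_i}$, $K_i=e^{d_ihH_i}$. For a skew-symmetric complex matrix $c=(c_{ij})$ let $U^{c}$ be the algebra topologically generated over $\mathbb C[[h]]$ (in the $h$-adic topology) by $e_i,f_i,H_i$ $(1\le i\le l)$ with the relations $[H_i,H_j]=0$, $[H_i,e_j]=a_{ij}e_j$, $[H_i,f_j]=-a_{ij}f_j$, $$e_if_j-q^{-c_{ij}}f_je_i=\delta_{ij}\frac{K_i-K_i^{-1}}{q_i-q_i^{-1}},$$ $$\sum_{r=0}^{1-a_{ij}}(-1)^rq^{rc_{ij}}\begin{bmatrix}1-a_{ij}\\ r\end{bmatrix}_{q_i}x_i^{1-a_{ij}-r}x_jx_i^r=0\qquad(i\ne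 j)$$ for $x=e$ and for $x=f$. The standard quantum group is $U_h(\mathfrak g)=U^{0}$; there we write $X_i^+=e_i$, $X_i^-=f_i$. Let $Y_i=\sum_jd_i(a^{-1})_{ij}H_j$ and $L_i^z=e^{hzY_i}$ for $z\in\mathbb C$. Let $\pi\in S_l$, let $s_\pi=s_{\pi(1)}\cdots s_{\pi(l)}$ be the corresponding Coxeter element, $c^\pi_{ij}=\left(\frac{1+s_\pi}{1-s_\pi}\alpha_i,\alpha_j\right)$ and $U_h^{s_\pi}(\mathfrak g)=U^{c^\pi}$. Let $U_h^{s_\pi}(\mathfrak n_+)$ and $U_h^{s_\pi}(\mathfrak n_-)$ be the subalgebras of $U_h^{s_\pi}(\mathfrak g)$ generated by the $e_i$ and by the $f_i$, respectively. Let $n_{ij}\in\mathbb C$ satisfy $d_jn_{ij}-d_in_{ji}=c^\pi_{ij}$ for all $i,j$. Let $K\in\operatorname{End}\mathfrak h$ be given by $KH_i=\sum_j\frac{n_{ij}}{d_i}Y_j$, and for $\beta=\sum_i m_i\alpha_i$ put $\beta^\vee=\sum_i m_id_iH_i$. An ordering of $\Delta_+$ is called normal if whenever $\gamma=\alpha+\beta$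 with $\alpha,\beta,\gamma\in\Delta_+$, either $\alpha<\gamma<\beta$ or $\beta<\gamma<\alpha$. Fix a normal ordering in which the simple roots appear in the order $\alpha_{\pi(1)},\dots,\alpha_{\pi(l)}$. Let $X^\pm_\beta\in U_h(\mathfrak g)$, $\beta\in\Delta_+$, be root vectors constructed along this ordering: $X^\pm_{\alpha_i}=X_i^\pm$, and each non-simple $\gamma\in\Delta_+$ has a decomposition $\gamma=\alpha+\beta$ with $\alpha,\beta\in\Delta_+$, $\alpha<\beta$, whose segment $[\alpha,\beta]$ is minimal (it contains no other pair $\alpha',\beta'$ with $\gamma=\alpha'+\beta'$), such that $$X_\gamma^+=X_\alpha^+X_\beta^+-q^{(\alpha,\beta)}X_\beta^+X_\alpha^+,\qquad X_\gamma^-=X_\beta^-X_\alpha^--q^{-(\alpha,\beta)}X_\alpha^-X_\beta^-.$$ Let $\chi_h^{s_\pi}:U_h^{s_\pi}(\mathfrak n_+)\to\mathbb C[[h]]$ and $\overline\chi_h^{s_\pi}:U_h^{s_\pi}(\mathfrak n_-)\to\mathbb C[[h]]$ be characters ($\mathbb C[[h]]$-algebra homomorphisms) with arbitrary prescribed non-zero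 values in $\mathbb C[[h]]$ on the generators $e_i$ and $f_i$, respectively. Then there is an isomorphism of $\mathbb C[[h]]$-algebras $\psi:U_h^{s_\pi}(\mathfrak g)\to U_h(\mathfrak g)$ with $$\psi(e_i)=X_i^+\prod_{p}L_p^{n_{ip}},\qquad \psi(f_i)=\prod_{p}L_p^{-n_{ip}}X_i^-,\qquad \psi(H_i)=H_i,$$ and for every such $\psi$ and every non-simple $\beta\in\Delta_+$ the elements $$e_\beta=\psi^{-1}(X_\beta^+e^{hK\beta^\vee}),\qquad f_\beta=\psi^{-1}(e^{-hK\beta^\vee}X_\beta^-)$$ lie in $U_h^{s_\pi}(\mathfrak n_+)$ and $U_h^{s_\pi}(\mathfrak n_-)$, respectively, and $$\chi_h^{s_\pi}(e_\beta)=0,\qquad \overline\chi_h^{s_\pi}(f_\beta)=0.$$ -/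

import Mathlib

open scoped PowerSeries Nat

noncomputable section

namespace CoxeterQG

/-! ### Scalars: the ring `ℂ⟦h⟧`, the element `q = e^h`, quantum integers -/

/-- `q ^ c = e ^ (c h) = ∑ cⁿ hⁿ / n!` in `ℂ⟦h⟧`, for a complex exponent `c`. -/
def qpow (c : ℂ) : ℂ⟦X⟧ := PowerSeries.mk fun n => c ^ n / (n ! : ℂ)

theorem constantCoeff_qpow (c : ℂ) : PowerSeries.constantCoeff (qpow c) = 1 := by
  rw [← PowerSeries.coeff_zero_eq_constantCoeff_apply]
  simp [qpow]

theorem qpow_zero : qpow 0 = 1 := by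
  ext n
  rcases Nat.eq_zero_or_pos n with rfl | hn
  · simp [qpow]
  · simp [qpow, PowerSeries.coeff_one, hn.ne']

theorem qpow_add (a b : ℂ) : qpow (a + b) = qpow a * qpow b := by
  have h (c : ℂ) : qpow c = PowerSeries.rescale c (PowerSeries.exp ℂ) := by
    ext n
    simp [qpow, PowerSeries.coeff_rescale, PowerSeries.coeff_exp, div_eq_mul_inv]
  rw [h, h, h, PowerSeries.exp_mul_exp_eq_exp_add]

/-- The quantum integer `[n]_Q = (Qⁿ - Q⁻ⁿ) / (Q - Q⁻¹)` for `Q = q ^ d`, written as the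
Laurent polynomial `Q^(n-1) + Q^(n-3) + ⋯ + Q^(1-n)`. -/
def qInt (d : ℂ) (n : ℕ) : ℂ⟦X⟧ :=
  ∑ k ∈ Finset.range n, qpow (d * ((n : ℂ) - 1 - 2 * (k : ℂ)))

theorem qInt_mul (d : ℂ) (n : ℕ) :
    qInt d n * (qpow d - qpow (-d)) = qpow (d * n) - qpow (-(d * n)) := by
  have h : ∀ k ∈ Finset.range n,
      qpow (d * ((n : ℂ) - 1 - 2 * (k : ℂ))) * (qpow d - qpow (-d)) =
        qpow (d * ((n : ℂ) - 2 * (k : ℂ))) - qpow (d * ((n : ℂ) - 2 * ((k + 1 : ℕ) : ℂ))) := by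
    intro k _
    rw [mul_sub, ← qpow_add, ← qpow_add]
    congr 2 <;> push_cast <;> ring
  rw [qInt, Finset.sum_mul, Finset.sum_congr rfl h,
    Finset.sum_range_sub' (fun k : ℕ => qpow (d * ((n : ℂ) - 2 * (k : ℂ))))]
  congr 2 <;> push_cast <;> ring

/-- The quantum factorial `[n]_Q!` for `Q = q ^ d`. -/
def qFact (d : ℂ) (n : ℕ) : ℂ⟦X⟧ := ∏ k ∈ Finset.range n, qInt d (k + 1)

theorem constantCoeff_qFact_ne_zero (d : ℂ) (n : ℕ) :
    PowerSeries.constantCoeff (qFact d n) ≠ 0 := by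
  rw [qFact, map_prod]
  refine Finset.prod_ne_zero_iff.mpr fun k _ => ?_
  simp only [qInt, map_sum, constantCoeff_qpow, Finset.sum_const, Finset.card_range]
  simp only [nsmul_eq_mul, mul_one]
  exact_mod_cast Nat.succ_ne_zero k

/-- The quantum binomial coefficient `[m]_Q! / ([r]_Q! [m-r]_Q!)` for `Q = q ^ d`; the denominator
is a unit of `ℂ⟦h⟧`. -/
def qBinom (d : ℂ) (m r : ℕ) : ℂ⟦X⟧ := qFact d m * (qFact d r * qFact d (m - r))⁻¹

theorem qBinom_mul (d : ℂ) (m r : ℕ) :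
    qBinom d m r * (qFact d r * qFact d (m - r)) = qFact d m := by
  rw [qBinom, mul_assoc, PowerSeries.inv_mul_cancel, mul_one]
  rw [map_mul]
  exact mul_ne_zero (constantCoeff_qFact_ne_zero d r) (constantCoeff_qFact_ne_zero d (m - r))

/-! ### The `h`-adically completed free algebra -/

/-- Names of the generators: `e i`, `f i` (written `X_i⁺`, `X_i⁻` in the standard quantum group)
and `H i`. -/
inductive Gen (l : ℕ) : Type
  | e (i : Fin l)
  | f (i : Fin l)
  | H (i : Fin l)

/-- The free algebra over `ℂ⟦h⟧` topologically generated by `e i`, `f i`, `H i`, i.e. the `h`-adic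
completion of the free `ℂ⟦h⟧`-algebra: formal power series in the central variable `h` with
coefficients in the free complex algebra. -/
abbrev FreeTop (l : ℕ) : Type := PowerSeries (FreeAlgebra ℂ (Gen l))

instance instAlgebraFreeTop (l : ℕ) : Algebra ℂ⟦X⟧ (FreeTop l) :=
  RingHom.toAlgebra' (PowerSeries.map (algebraMap ℂ (FreeAlgebra ℂ (Gen l)))) (by
    intro c x
    ext n
    rw [PowerSeries.coeff_mul, PowerSeries.coeff_mul, ← Finset.Nat.sum_antidiagonal_swap]
    refine Finset.sum_congr rfl fun p _ => ?_
    simp [Algebra.commutes])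

/-- A generator, as an element of the completed free algebra. -/
def gen {l : ℕ} (g : Gen l) : FreeTop l := PowerSeries.C (FreeAlgebra.ι ℂ g)

/-- The element `∑ v_j H_j` of the free algebra. -/
def cartanElt {l : ℕ} (v : Fin l → ℂ) : FreeAlgebra ℂ (Gen l) :=
  ∑ j, v j • FreeAlgebra.ι ℂ (Gen.H j)

/-- `exp (h ∑ v_j H_j) = ∑ hⁿ (∑ v_j H_j)ⁿ / n!`. -/
def expFree {l : ℕ} (v : Fin l → ℂ) : FreeTop l :=
  PowerSeries.mk fun n => ((n ! : ℂ)⁻¹) • cartanElt v ^ n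

/-- For a power series without constant term this is division by `h`. -/
def divh {A : Type*} [Semiring A] (x : PowerSeries A) : PowerSeries A :=
  PowerSeries.mk fun n => PowerSeries.coeff (n + 1) x

/-- The element `(K_i - K_i⁻¹) / (q_i - q_i⁻¹)`, where `K_i = exp (d_i h H_i)`, `q_i = q ^ d_i`;
numerator and denominator are divisible by `h`, and after division by `h` the denominator is
a unit of `ℂ⟦h⟧`. -/
def cartanFrac {l : ℕ} (d : Fin l → ℕ) (i : Fin l) : FreeTop l :=
  (divh (qpow (d i) - qpow (-(d i : ℂ))))⁻¹ •
    divh (expFree (Pi.single i (d i : ℂ)) - expFree (Pi.single i (-(d i : ℂ))))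

theorem X_mul_divh {A : Type*} [Semiring A] (x : PowerSeries A)
    (hx : PowerSeries.coeff 0 x = 0) : PowerSeries.X * divh x = x := by
  ext n
  cases n with
  | zero => simpa using hx.symm
  | succ n => simp [divh, PowerSeries.coeff_succ_X_mul]

theorem cartanFrac_spec {l : ℕ} (d : Fin l → ℕ) (i : Fin l) (hd : 0 < d i) :
    (qpow (d i) - qpow (-(d i : ℂ))) • cartanFrac d i =
      expFree (Pi.single i (d i : ℂ)) - expFree (Pi.single i (-(d i : ℂ))) := by
  have h1 : PowerSeries.coeff 0 (qpow (d i) - qpow (-(d i : ℂ))) = 0 := by simp [qpow]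
  have h2 : PowerSeries.coeff 0
      (expFree (Pi.single i (d i : ℂ)) - expFree (Pi.single i (-(d i : ℂ)))) = 0 := by
    simp [expFree]
  have h3 : PowerSeries.constantCoeff (divh (qpow (d i) - qpow (-(d i : ℂ)))) ≠ 0 := by
    rw [← PowerSeries.coeff_zero_eq_constantCoeff_apply]
    have : (d i : ℂ) + (d i : ℂ) ≠ 0 := by
      exact_mod_cast (by omega : d i + d i ≠ 0)
    simpa [divh, qpow] using this
  conv_lhs => rw [← X_mul_divh _ h1]
  rw [cartanFrac, smul_smul, mul_assoc, PowerSeries.mul_inv_cancel _ h3, mul_one,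
    Algebra.smul_def]
  have h4 : algebraMap ℂ⟦X⟧ (FreeTop l) PowerSeries.X = PowerSeries.X := by
    change PowerSeries.map _ _ = _
    simp
  rw [h4, X_mul_divh _ h2]

/-! ### The quantum group and its Coxeter realizations -/

/-- The (left hand sides minus right hand sides of the) defining relations attached to a Cartan
matrix `a`, symmetrizing integers `d` and a skew-symmetric complex matrix `c`. For `c = 0` they are
the defining relations of the standard quantum group, with `X_i⁺ = e i` and `X_i⁻ = f i`. -/
inductive IsRelator {l : ℕ} (a : Matrix (Fin l) (Fin l) ℤ) (d : Fin l → ℕ)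
    (c : Fin l → Fin l → ℂ) : FreeTop l → Prop
  | HH (i j : Fin l) :
      IsRelator a d c (gen (.H i) * gen (.H j) - gen (.H j) * gen (.H i))
  | He (i j : Fin l) :
      IsRelator a d c (gen (.H i) * gen (.e j) - gen (.e j) * gen (.H i) - a i j • gen (.e j))
  | Hf (i j : Fin l) :
      IsRelator a d c (gen (.H i) * gen (.f j) - gen (.f j) * gen (.H i) + a i j • gen (.f j))
  | ef (i j : Fin l) :
      IsRelator a d c (gen (.e i) * gen (.f j) - qpow (-(c i j)) • (gen (.f j) * gen (.e i)) -
        if i = j then cartanFrac d i else 0)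
  | serre_e (i j : Fin l) (hij : i ≠ j) :
      IsRelator a d c (∑ r ∈ Finset.range ((1 - a i j).toNat + 1),
        ((-1) ^ r * qpow (r * c i j) * qBinom (d i) (1 - a i j).toNat r) •
          (gen (.e i) ^ ((1 - a i j).toNat - r) * gen (.e j) * gen (.e i) ^ r))
  | serre_f (i j : Fin l) (hij : i ≠ j) :
      IsRelator a d c (∑ r ∈ Finset.range ((1 - a i j).toNat + 1),
        ((-1) ^ r * qpow (r * c i j) * qBinom (d i) (1 - a i j).toNat r) •
          (gen (.f i) ^ ((1 - a i j).toNat - r) * gen (.f j) * gen (.f i) ^ r))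

/-- The `h`-adic closure of a two-sided ideal of the completed free algebra: `x` lies in it iff for
every `n` some element of the ideal is congruent to `x` modulo `hⁿ`. -/
def hClosure {l : ℕ} (I : TwoSidedIdeal (FreeTop l)) : TwoSidedIdeal (FreeTop l) :=
  TwoSidedIdeal.mk'
    {x | ∀ n : ℕ, ∃ y ∈ I, ∀ k < n, PowerSeries.coeff k x = PowerSeries.coeff k y}
    (fun _ => ⟨0, I.zero_mem, fun _ _ => rfl⟩)
    (by
      intro x x' hx hx' n
      obtain ⟨y, hy, h⟩ := hx n
      obtain ⟨y', hy', h'⟩ := hx' n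
      exact ⟨y + y', I.add_mem hy hy', fun k hk => by rw [map_add, map_add, h k hk, h' k hk]⟩)
    (by
      intro x hx n
      obtain ⟨y, hy, h⟩ := hx n
      exact ⟨-y, I.neg_mem hy, fun k hk => by rw [map_neg, map_neg, h k hk]⟩)
    (by
      intro x x' hx' n
      obtain ⟨y', hy', h'⟩ := hx' n
      refine ⟨x * y', I.mul_mem_left _ _ hy', fun k hk => ?_⟩
      rw [PowerSeries.coeff_mul, PowerSeries.coeff_mul]
      refine Finset.sum_congr rfl fun p hp => ?_
      rw [h' p.2 (by have := Finset.HasAntidiagonal.mem_antidiagonal.mp hp; omega)])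
    (by
      intro x x' hx n
      obtain ⟨y, hy, h⟩ := hx n
      refine ⟨y * x', I.mul_mem_right _ _ hy, fun k hk => ?_⟩
      rw [PowerSeries.coeff_mul, PowerSeries.coeff_mul]
      refine Finset.sum_congr rfl fun p hp => ?_
      rw [h p.1 (by have := Finset.HasAntidiagonal.mem_antidiagonal.mp hp; omega)])

/-- The closed two-sided ideal generated by the defining relations. -/
def relIdeal {l : ℕ} (a : Matrix (Fin l) (Fin l) ℤ) (d : Fin l → ℕ) (c : Fin l → Fin l → ℂ) :
    TwoSidedIdeal (FreeTop l) :=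
  hClosure (TwoSidedIdeal.span {x | IsRelator a d c x})

/-- The `ℂ⟦h⟧`-algebra topologically generated by `e i`, `f i`, `H i` with the above defining
relations. -/
abbrev QAlg {l : ℕ} (a : Matrix (Fin l) (Fin l) ℤ) (d : Fin l → ℕ) (c : Fin l → Fin l → ℂ) :
    Type :=
  (relIdeal a d c).ringCon.Quotient

/-- The standard quantum group `U_h(𝔤)`. -/
abbrev Uh {l : ℕ} (a : Matrix (Fin l) (Fin l) ℤ) (d : Fin l → ℕ) : Type :=
  QAlg a d (fun _ _ => 0)

section QAlg

variable {l : ℕ} (a : Matrix (Fin l) (Fin l) ℤ) (d : Fin l → ℕ) (c : Fin l → Fin l → ℂ)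

/-- The quotient map. -/
def toQAlg : FreeTop l →ₐ[ℂ⟦X⟧] QAlg a d c := RingCon.mkₐ ℂ⟦X⟧ (relIdeal a d c).ringCon

/-- The generator `e i`, or `X_i⁺`. -/
def genE (i : Fin l) : QAlg a d c := toQAlg a d c (gen (.e i))

/-- The generator `f i`, or `X_i⁻`. -/
def genF (i : Fin l) : QAlg a d c := toQAlg a d c (gen (.f i))

/-- The generator `H i`. -/
def genH (i : Fin l) : QAlg a d c := toQAlg a d c (gen (.H i))

/-- The element `exp (h ∑ v_j H_j)`. -/
def expCartan (v : Fin l → ℂ) : QAlg a d c := toQAlg a d c (expFree v)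

/-- The subalgebra generated by the `e i`. -/
def nPlus : Subalgebra ℂ⟦X⟧ (QAlg a d c) := Algebra.adjoin ℂ⟦X⟧ (Set.range (genE a d c))

/-- The subalgebra generated by the `f i`. -/
def nMinus : Subalgebra ℂ⟦X⟧ (QAlg a d c) := Algebra.adjoin ℂ⟦X⟧ (Set.range (genF a d c))

theorem genE_mem (i : Fin l) : genE a d c i ∈ nPlus a d c :=
  Algebra.subset_adjoin ⟨i, rfl⟩

theorem genF_mem (i : Fin l) : genF a d c i ∈ nMinus a d c :=
  Algebra.subset_adjoin ⟨i, rfl⟩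

/-- `Y_i = ∑_j d_i (a⁻¹)_{ij} H_j`, by its coordinates with respect to `H_1, …, H_l`. -/
def weightY (i j : Fin l) : ℂ := d i * (a.map (Int.cast : ℤ → ℂ))⁻¹ i j

/-- The complex power `L_p ^ z = exp (h z Y_p)` in the standard quantum group. -/
def powL (p : Fin l) (z : ℂ) : Uh a d := expCartan a d _ (z • weightY a d p)

/-- The operator `K` on the Cartan subalgebra, `K H_i = ∑_p (n_{ip} / d_i) Y_p`, in coordinates
with respect to `H_1, …, H_l`. -/
def opK (n : Fin l → Fin l → ℂ) (v : Fin l → ℂ) : Fin l → ℂ :=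
  ∑ i, v i • ∑ p, (n i p / (d i : ℂ)) • weightY a d p

/-- `ψ` is given on generators by `e_i ↦ X_i⁺ ∏_p L_p^{n_{ip}}`, `f_i ↦ ∏_p L_p^{-n_{ip}} X_i⁻`,
`H_i ↦ H_i`. -/
def IsCoxeterIso (n : Fin l → Fin l → ℂ) (ψ : QAlg a d c ≃ₐ[ℂ⟦X⟧] Uh a d) : Prop :=
  ∀ i, ψ (genE a d c i) = genE a d _ i * (List.ofFn fun p => powL a d p (n i p)).prod ∧
    ψ (genF a d c i) = (List.ofFn fun p => powL a d p (-(n i p))).prod * genF a d _ i ∧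
    ψ (genH a d c i) = genH a d _ i

end QAlg

/-! ### Root systems -/

section Roots

variable {ι M N : Type*} [AddCommGroup M] [Module ℂ M] [AddCommGroup N] [Module ℂ N]
  {P : RootPairing ι ℂ M N} [P.IsCrystallographic] (b : P.Base) {l : ℕ} (α : Fin l ≃ b.support)

/-- The Cartan matrix `a_{ij} = α_j(H_i)`, where `H_i` is the coroot of the simple root `α_i`. -/
def cartanMat : Matrix (Fin l) (Fin l) ℤ :=
  Matrix.of fun i j => P.pairingIn ℤ (α j) (α i)

/-- `d_1, …, d_l` are coprime positive integers such that `b_{ij} = d_i a_{ij}` is symmetric. -/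
def IsSymmetrizer (d : Fin l → ℕ) : Prop :=
  (∀ i, 0 < d i) ∧ Finset.univ.gcd d = 1 ∧
    ∀ i j, (d i : ℤ) * cartanMat b α i j = (d j : ℤ) * cartanMat b α j i

/-- The indices of the positive roots. -/
abbrev PosRoot : Type _ := {i : ι // b.IsPos i}

/-- A simple root as a positive root. -/
def simpleRoot (i : Fin l) : PosRoot b :=
  ⟨α i, RootPairing.Base.isPos_of_mem_support (α i).2⟩

/-- An ordering `β_1 < … < β_m` of the positive roots is normal if for all positive roots with
`z = x + y` either `x < z < y` or `y < z < x`. -/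
def IsNormalOrdering {m : ℕ} (β : Fin m ≃ PosRoot b) : Prop :=
  ∀ x y z : PosRoot b, P.root z = P.root x + P.root y →
    (β.symm x < β.symm z ∧ β.symm z < β.symm y) ∨ (β.symm y < β.symm z ∧ β.symm z < β.symm x)

variable [P.IsRootSystem]

/-- The simple roots as a basis. -/
def simpleBasis : Module.Basis (Fin l) ℂ M := b.toWeightBasis.reindex α.symm

/-- The bilinear form with `(α_i, α_j) = b_{ij} = d_i a_{ij}`. -/
def form (d : Fin l → ℕ) : LinearMap.BilinForm ℂ M :=
  Matrix.toBilin (simpleBasis b α) (Matrix.of fun i j => (d i : ℂ) * (cartanMat b α i j : ℂ))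

/-- `γ^∨ = ∑ m_i d_i H_i` for `γ = ∑ m_i α_i`, in coordinates with respect to `H_1, …, H_l`. -/
def checkVec (d : Fin l → ℕ) (γ : PosRoot b) : Fin l → ℂ :=
  fun i => (simpleBasis b α).repr (P.root γ) i * (d i : ℂ)

/-- The Coxeter element `s_π = s_{π(1)} ⋯ s_{π(l)}`. -/
def coxeter (π : Equiv.Perm (Fin l)) : Module.End ℂ M :=
  (List.ofFn fun k => (P.reflection (α (π k))).toLinearMap).prod

/-- The matrix elements `((1 + s_π) (1 - s_π)⁻¹ α_i, α_j)` of the Cayley transform of the Coxeter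
element (`1 - s_π` is invertible). -/
def cayley (d : Fin l → ℕ) (π : Equiv.Perm (Fin l)) (i j : Fin l) : ℂ :=
  form b α d (((1 + coxeter b α π) * Ring.inverse (1 - coxeter b α π)) (P.root (α i)))
    (P.root (α j))

/-- `Xp`, `Xm` is a family of positive and negative root vectors of the standard quantum group
obtained by the inductive algorithm along the ordering `β`: for simple roots they are the
generators, and for every other positive root `γ` there is a decomposition `γ = x + y`, `x < y`,
for which the segment `[x, y]` is minimal, such that
`X_γ⁺ = X_x⁺ X_y⁺ - q^{(x,y)} X_y⁺ X_x⁺` and `X_γ⁻ = X_y⁻ X_x⁻ - q^{-(x,y)} X_x⁻ X_y⁻`. -/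
def IsRootVectors (d : Fin l → ℕ) {m : ℕ} (β : Fin m ≃ PosRoot b)
    (Xp Xm : PosRoot b → Uh (cartanMat b α) d) : Prop :=
  (∀ i, Xp (simpleRoot b α i) = genE _ _ _ i ∧ Xm (simpleRoot b α i) = genF _ _ _ i) ∧
  ∀ γ : PosRoot b, (γ : ι) ∉ b.support →
    ∃ x y : PosRoot b, P.root γ = P.root x + P.root y ∧ β.symm x < β.symm y ∧
      (∀ x' y' : PosRoot b, P.root γ = P.root x' + P.root y' →
        β.symm x ≤ β.symm x' → β.symm x' < β.symm y' → β.symm y' ≤ β.symm y →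
          x' = x ∧ y' = y) ∧
      Xp γ = Xp x * Xp y - qpow (form b α d (P.root x) (P.root y)) • (Xp y * Xp x) ∧
      Xm γ = Xm y * Xm x - qpow (-(form b α d (P.root x) (P.root y))) • (Xm x * Xm y)

end Roots

end CoxeterQG

end

/-!
The algebras `U^c` for different parameter matrices `c` differ only by Cartan factors. If `t_i` is
the vector `∑_p n_{ip} Y_p` of the Cartan subalgebra, then `α_j(t_i) = d_j n_{ij}`, so moving
`exp (h t_i)` past `e_j` costs `q^{d_j n_{ij}}`. In the twisted elements `e_i exp (h t_i)` and
`exp (-h t_i) f_i` these powers of `q` change the parameter matrix by the antisymmetrization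
`d_j n_{ij} - d_i n_{ji}` (`liftFree_twistGen_relator`), and twisting by `-t` inverts twisting
by `t` (`twistEquiv`). All analysis is `h`-adic: the algebras are separated and complete
(`instHAdicQAlg`), hence homomorphisms are continuous and determined by the generators, and
exponentials behave as expected (`HasExp.mul`, `HasExp.intertwine`).

For the second half, multiplying the `q`-commutator that defines the root vector of `γ = x + y` by
the Cartan exponential of `γ` gives a combination of `e_x e_y` and `e_y e_x` whose coefficients are
powers of `q` (`qcomm_mul_expCartan`). Induction on the height shows that `e_γ` lies in the
subalgebra generated by the `e_i`, and that a character kills it as soon as it kills `e_x` or `e_y`.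
The remaining case is that `x = α_i` and `y = α_j` are both simple, `α_i < α_j`. Then the ratio of
the two coefficients is `q` to the power `(α_i, α_j) + c_{ij}`, and this exponent vanishes by
`cayley_of_lt`: above the diagonal, in the order of the Coxeter element `s`, the matrix of the
Cayley transform is that of `-(·, ·)`. Indeed `x - s x = ∑ t_k α_k` where
`t_k + ∑_{j > k} a_{kj} t_j` is the value of `x` on the coroot of `α_k`, so that the vector `v` with
`v - s v = α_i` is orthogonal to all later simple roots, and
`(1 + s) (1 - s)⁻¹ α_i = 2 v - α_i`.
-/

noncomputable section

namespace CoxeterQG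

/-! ### `h`-adic sums and exponentials -/

section HSum

variable {M N : Type*} [AddCommGroup M] [Module ℂ⟦X⟧ M] [AddCommGroup N] [Module ℂ⟦X⟧ N]

/-- `s` is the sum of the `h`-adically convergent series `∑ hᵏ f k`: for every `n` it is congruent
to the `n`-th partial sum modulo `hⁿ`. -/
def HasHSum (f : ℕ → M) (s : M) : Prop :=
  ∀ n, ∃ z, s = ∑ k ∈ Finset.range n, (PowerSeries.X : ℂ⟦X⟧) ^ k • f k +
    (PowerSeries.X : ℂ⟦X⟧) ^ n • z

variable (M) in
/-- A `ℂ⟦h⟧`-module that is separated and complete in the `h`-adic topology. -/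
class HAdic : Prop where
  eq_zero_of_forall_eq_smul :
    ∀ x : M, (∀ n, ∃ z, x = (PowerSeries.X : ℂ⟦X⟧) ^ n • z) → x = 0
  exists_hasHSum : ∀ f : ℕ → M, ∃ s, HasHSum f s

theorem HasHSum.congr {f g : ℕ → M} {s : M} (hs : HasHSum f s) (h : ∀ k, f k = g k) :
    HasHSum g s :=
  (funext h : f = g) ▸ hs

theorem HasHSum.unique [HAdic M] {f : ℕ → M} {s t : M} (hs : HasHSum f s) (ht : HasHSum f t) :
    s = t := by
  refine sub_eq_zero.mp (HAdic.eq_zero_of_forall_eq_smul _ fun n => ?_)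
  obtain ⟨z, hz⟩ := hs n
  obtain ⟨w, hw⟩ := ht n
  exact ⟨z - w, by rw [hz, hw, smul_sub]; abel⟩

theorem HasHSum.add {f g : ℕ → M} {s t : M} (hs : HasHSum f s) (ht : HasHSum g t) :
    HasHSum (fun k => f k + g k) (s + t) := by
  intro n
  obtain ⟨z, hz⟩ := hs n
  obtain ⟨w, hw⟩ := ht n
  refine ⟨z + w, ?_⟩
  simp only [smul_add, Finset.sum_add_distrib]
  rw [hz, hw]
  abel

theorem HasHSum.map {f : ℕ → M} {s : M} (hs : HasHSum f s) (L : M →ₗ[ℂ⟦X⟧] N) :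
    HasHSum (fun k => L (f k)) (L s) := by
  intro n
  obtain ⟨z, hz⟩ := hs n
  exact ⟨L z, by rw [hz, map_add, map_sum]; simp⟩

/-- The series with the single term `a` in degree zero. -/
theorem hasHSum_single (a : M) : HasHSum (fun k => if k = 0 then a else 0) a := by
  intro n
  cases n with
  | zero => exact ⟨a, by simp⟩
  | succ n =>
    refine ⟨0, ?_⟩
    rw [Finset.sum_range_succ']
    simp

variable {B C : Type*} [Ring B] [Algebra ℂ⟦X⟧ B] [Ring C] [Algebra ℂ⟦X⟧ C]

/-- The Cauchy product of two convergent series. -/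
theorem HasHSum.mul {f g : ℕ → B} {s t : B} (hs : HasHSum f s) (ht : HasHSum g t) :
    HasHSum (fun k => ∑ p ∈ Finset.HasAntidiagonal.antidiagonal k, f p.1 * g p.2) (s * t) := by
  intro n
  obtain ⟨z, hz⟩ := hs n
  choose w hw using ht
  refine ⟨z * t + ∑ i ∈ Finset.range n, f i * w (n - i), ?_⟩
  have key : ∑ k ∈ Finset.range n, (PowerSeries.X : ℂ⟦X⟧) ^ k •
        ∑ p ∈ Finset.HasAntidiagonal.antidiagonal k, f p.1 * g p.2 =
      ∑ i ∈ Finset.range n, ∑ j ∈ Finset.range (n - i),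
        (PowerSeries.X : ℂ⟦X⟧) ^ (i + j) • (f i * g j) := by
    rw [← Finset.sum_range_diag_flip n
      (fun i j => (PowerSeries.X : ℂ⟦X⟧) ^ (i + j) • (f i * g j))]
    refine Finset.sum_congr rfl fun k _ => ?_
    rw [Finset.Nat.sum_antidiagonal_eq_sum_range_succ_mk, Finset.smul_sum]
    refine Finset.sum_congr rfl fun i hi => ?_
    rw [Nat.add_sub_cancel' (Nat.lt_succ_iff.mp (Finset.mem_range.mp hi))]
  rw [key]
  conv_lhs => rw [hz]
  rw [add_mul, Finset.sum_mul, smul_add, Finset.smul_sum, smul_mul_assoc, add_comm (_ • (z * t)),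
    ← add_assoc, ← Finset.sum_add_distrib]
  congr 1
  refine Finset.sum_congr rfl fun i hi => ?_
  conv_lhs => rw [hw (n - i)]
  rw [mul_add, Finset.mul_sum]
  congr 1
  · refine Finset.sum_congr rfl fun j _ => ?_
    rw [smul_mul_assoc, mul_smul_comm, smul_smul, pow_add]
  · rw [smul_mul_assoc, mul_smul_comm, smul_smul, ← pow_add,
      Nat.add_sub_cancel' (Finset.mem_range.mp hi).le]

variable [Algebra ℂ B] [Algebra ℂ C]

/-- `E = exp (h u) = ∑ hⁿ uⁿ / n!`. -/
def HasExp (u E : B) : Prop := HasHSum (fun n => ((n ! : ℂ)⁻¹) • u ^ n) E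

theorem HasExp.unique [HAdic B] {u E F : B} (hE : HasExp u E) (hF : HasExp u F) : E = F :=
  HasHSum.unique hE hF

theorem HasExp.mul {u v E F : B} (huv : Commute u v) (hE : HasExp u E) (hF : HasExp v F) :
    HasExp (u + v) (E * F) := by
  refine (HasHSum.mul hE hF).congr fun n => Eq.symm ?_
  rw [huv.add_pow', Finset.smul_sum]
  refine Finset.sum_congr rfl fun p hp => ?_
  rw [smul_mul_smul_comm, ← Nat.cast_smul_eq_nsmul ℂ, smul_smul]
  congr 1
  obtain rfl := Finset.HasAntidiagonal.mem_antidiagonal.mp hp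
  have h0 : ((p.1 + p.2).choose p.1 : ℂ) * (p.1)! * (p.2)! = (p.1 + p.2)! := by
    have h := Nat.choose_mul_factorial_mul_factorial (Nat.le_add_right p.1 p.2)
    rw [Nat.add_sub_cancel_left] at h
    exact_mod_cast h
  have h1 : ((p.1 + p.2)! : ℂ) ≠ 0 := by exact_mod_cast Nat.factorial_ne_zero _
  have h2 : ((p.1)! : ℂ) ≠ 0 := by exact_mod_cast Nat.factorial_ne_zero _
  have h3 : ((p.2)! : ℂ) ≠ 0 := by exact_mod_cast Nat.factorial_ne_zero _
  field_simp
  linear_combination h0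

/-- If `u x = x v`, then `exp (h u) x = x exp (h v)`. -/
theorem HasExp.intertwine [HAdic B] {u v E F x : B} (h : u * x = x * v) (hE : HasExp u E)
    (hF : HasExp v F) : E * x = x * F := by
  have h1 := HasHSum.map hE (LinearMap.mulRight ℂ⟦X⟧ x)
  have h2 := HasHSum.map hF (LinearMap.mulLeft ℂ⟦X⟧ x)
  have h3 : ∀ n : ℕ, u ^ n * x = x * v ^ n := fun n =>
    (SemiconjBy.pow_right (show SemiconjBy x v u from h.symm) n).eq.symm
  exact HasHSum.unique h1 (h2.congr fun n => by simp [h3])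

variable [IsScalarTower ℂ ℂ⟦X⟧ B] [IsScalarTower ℂ ℂ⟦X⟧ C]

theorem HasExp.map {u E : B} (hE : HasExp u E) (ρ : B →ₐ[ℂ⟦X⟧] C) : HasExp (ρ u) (ρ E) := by
  refine (HasHSum.map hE ρ.toLinearMap).congr fun n => ?_
  simp

end HSum

theorem eq_X_pow_mul_of_coeff_eq_zero {A : Type*} [Semiring A] {n : ℕ} {x : PowerSeries A}
    (h : ∀ k < n, PowerSeries.coeff k x = 0) :
    x = PowerSeries.X ^ n * PowerSeries.mk fun i => PowerSeries.coeff (i + n) x := by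
  ext k
  rw [PowerSeries.coeff_X_pow_mul']
  split_ifs with hk
  · simp [Nat.sub_add_cancel hk]
  · exact h k (by omega)

theorem hasHSum_C_coeff_complex (x : ℂ⟦X⟧) :
    HasHSum (fun k => algebraMap ℂ ℂ⟦X⟧ (PowerSeries.coeff k x)) x := by
  intro n
  refine ⟨_, (sub_eq_iff_eq_add'.mp (eq_X_pow_mul_of_coeff_eq_zero fun k hk => ?_))⟩
  simp only [map_sub, map_sum, smul_eq_mul, PowerSeries.coeff_X_pow_mul', PowerSeries.algebraMap_eq,
    PowerSeries.coeff_C]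
  rw [Finset.sum_eq_single k]
  · simp
  · intro j _ hj
    split_ifs with h1 h2
    · omega
    · rfl
    · rfl
  · intro h
    exact absurd (Finset.mem_range.mpr hk) h

/-- The exponential of a scalar multiple of the identity. -/
theorem hasExp_algebraMap {B : Type*} [Ring B] [Algebra ℂ⟦X⟧ B] [Algebra ℂ B]
    [IsScalarTower ℂ ℂ⟦X⟧ B] (c : ℂ) :
    HasExp (algebraMap ℂ B c) (algebraMap ℂ⟦X⟧ B (qpow c)) := by
  refine (HasHSum.map (hasHSum_C_coeff_complex (qpow c)) (Algebra.linearMap ℂ⟦X⟧ B)).congr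
    fun n => ?_
  rw [Algebra.linearMap_apply, ← IsScalarTower.algebraMap_apply, qpow, PowerSeries.coeff_mk,
    ← map_pow, Algebra.smul_def, ← map_mul, div_eq_inv_mul]

/-! ### The completed free algebra and its quotients -/

instance instIsScalarTowerFreeTop (l : ℕ) : IsScalarTower ℂ ℂ⟦X⟧ (FreeTop l) :=
  IsScalarTower.of_algebraMap_eq fun x => by
    change _ = PowerSeries.map _ _
    simp [PowerSeries.algebraMap_apply]

theorem X_pow_smul_freeTop {l : ℕ} (n : ℕ) (x : FreeTop l) :
    (PowerSeries.X : ℂ⟦X⟧) ^ n • x = PowerSeries.X ^ n * x := by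
  rw [Algebra.smul_def]
  change PowerSeries.map _ _ * _ = _
  simp

theorem coeff_X_pow_smul_freeTop {l : ℕ} (n k : ℕ) (x : FreeTop l) :
    PowerSeries.coeff k ((PowerSeries.X : ℂ⟦X⟧) ^ n • x) =
      if n ≤ k then PowerSeries.coeff (k - n) x else 0 := by
  rw [X_pow_smul_freeTop, PowerSeries.coeff_X_pow_mul']

theorem exists_eq_X_pow_smul {l : ℕ} {n : ℕ} {x y : FreeTop l}
    (h : ∀ k < n, PowerSeries.coeff k x = PowerSeries.coeff k y) :
    ∃ z, x = y + (PowerSeries.X : ℂ⟦X⟧) ^ n • z := by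
  refine ⟨_, (sub_eq_iff_eq_add'.mp ((eq_X_pow_mul_of_coeff_eq_zero fun k hk => ?_).trans
    (X_pow_smul_freeTop n _).symm))⟩
  rw [map_sub, h k hk, sub_self]

theorem hasHSum_mk {l : ℕ} (g : ℕ → FreeTop l) :
    HasHSum g (PowerSeries.mk fun n =>
      ∑ k ∈ Finset.range (n + 1), PowerSeries.coeff (n - k) (g k)) := by
  intro n
  refine exists_eq_X_pow_smul fun m hm => ?_
  rw [PowerSeries.coeff_mk, map_sum]
  simp only [coeff_X_pow_smul_freeTop]
  rw [← Finset.sum_filter]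
  refine Finset.sum_congr ?_ fun _ _ => rfl
  ext k
  simp only [Finset.mem_range, Finset.mem_filter]
  omega

theorem hasHSum_C_coeff {l : ℕ} (x : FreeTop l) :
    HasHSum (fun k => (PowerSeries.C (PowerSeries.coeff k x) : FreeTop l)) x := by
  refine cast ?_ (hasHSum_mk fun k => (PowerSeries.C (PowerSeries.coeff k x) : FreeTop l))
  congr 1
  ext n
  rw [PowerSeries.coeff_mk, Finset.sum_range_succ, Finset.sum_eq_zero]
  · simp
  · intro k hk
    rw [PowerSeries.coeff_C, if_neg]
    have := Finset.mem_range.mp hk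
    omega

theorem hasExp_expFree {l : ℕ} (v : Fin l → ℂ) :
    HasExp (PowerSeries.C (cartanElt v) : FreeTop l) (expFree v) := by
  refine (hasHSum_C_coeff (expFree v)).congr fun n => ?_
  rw [expFree, PowerSeries.coeff_mk, ← map_pow]
  ext k
  rw [PowerSeries.coeff_smul, PowerSeries.coeff_C, PowerSeries.coeff_C, smul_ite, smul_zero]

section QAlg

variable {l : ℕ} (a : Matrix (Fin l) (Fin l) ℤ) (d : Fin l → ℕ) (c : Fin l → Fin l → ℂ)

theorem mem_hClosure {I : TwoSidedIdeal (FreeTop l)} {x : FreeTop l} :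
    x ∈ hClosure I ↔
      ∀ n : ℕ, ∃ y ∈ I, ∀ k < n, PowerSeries.coeff k x = PowerSeries.coeff k y := by
  rw [hClosure, TwoSidedIdeal.mem_mk']
  rfl

theorem toQAlg_surjective : Function.Surjective (toQAlg a d c) :=
  RingCon.mkₐ_surjective _

theorem toQAlg_eq_zero {x : FreeTop l} : toQAlg a d c x = 0 ↔ x ∈ relIdeal a d c := by
  rw [TwoSidedIdeal.mem_iff, ← RingCon.eq]
  rfl

theorem toQAlg_relator {x : FreeTop l} (hx : IsRelator a d c x) : toQAlg a d c x = 0 := by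
  rw [toQAlg_eq_zero, relIdeal, mem_hClosure]
  exact fun n => ⟨x, TwoSidedIdeal.subset_span hx, fun _ _ => rfl⟩

instance instHAdicQAlg : HAdic (QAlg a d c) where
  eq_zero_of_forall_eq_smul := by
    intro x hx
    obtain ⟨x, rfl⟩ := toQAlg_surjective a d c x
    rw [toQAlg_eq_zero, relIdeal, mem_hClosure]
    intro n
    obtain ⟨z, hz⟩ := hx n
    obtain ⟨z, rfl⟩ := toQAlg_surjective a d c z
    rw [← map_smul, ← sub_eq_zero, ← map_sub, toQAlg_eq_zero, relIdeal, mem_hClosure] at hz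
    obtain ⟨y, hy, h⟩ := hz n
    refine ⟨y, hy, fun k hk => ?_⟩
    rw [← h k hk, map_sub, coeff_X_pow_smul_freeTop, if_neg (by omega), sub_zero]
  exists_hasHSum := by
    intro f
    choose g hg using fun k => toQAlg_surjective a d c (f k)
    exact ⟨_, (HasHSum.map (hasHSum_mk g) (toQAlg a d c).toLinearMap).congr hg⟩

end QAlg

/-! ### Universal properties -/

section Lift

variable {l : ℕ} {B : Type*} [Ring B] [Algebra ℂ⟦X⟧ B]

/-- Homomorphisms out of the completed free algebra are continuous, hence determined by their
restriction to constant power series. -/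
theorem freeTop_hom_congr [HAdic B] {f g : FreeTop l →ₐ[ℂ⟦X⟧] B} {x : FreeTop l}
    (h : ∀ k, f (PowerSeries.C (PowerSeries.coeff k x)) =
      g (PowerSeries.C (PowerSeries.coeff k x))) : f x = g x := by
  have h1 := HasHSum.map (hasHSum_C_coeff x) f.toLinearMap
  have h2 := HasHSum.map (hasHSum_C_coeff x) g.toLinearMap
  exact HasHSum.unique h1 (h2.congr fun k => (h k).symm)

/-- A homomorphism that kills the defining relations kills their closed ideal, by separatedness of
the target. -/
theorem eq_zero_of_mem_relIdeal [HAdic B] (a : Matrix (Fin l) (Fin l) ℤ) (d : Fin l → ℕ)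
    (c : Fin l → Fin l → ℂ) (f : FreeTop l →ₐ[ℂ⟦X⟧] B)
    (hf : ∀ x, IsRelator a d c x → f x = 0) {x : FreeTop l} (hx : x ∈ relIdeal a d c) :
    f x = 0 := by
  have hle : TwoSidedIdeal.span {x | IsRelator a d c x} ≤ TwoSidedIdeal.ker f :=
    TwoSidedIdeal.span_le.mpr fun x hx => (TwoSidedIdeal.mem_ker f).mpr (hf x hx)
  refine HAdic.eq_zero_of_forall_eq_smul _ fun n => ?_
  obtain ⟨y, hy, h⟩ := mem_hClosure.mp hx n
  obtain ⟨z, hz⟩ := exists_eq_X_pow_smul h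
  exact ⟨f z, by rw [hz, map_add, (TwoSidedIdeal.mem_ker f).mp (hle hy), zero_add, map_smul]⟩

/-- The universal property of the algebra topologically presented by generators and relations. -/
def liftQ [HAdic B] (a : Matrix (Fin l) (Fin l) ℤ) (d : Fin l → ℕ)
    (c : Fin l → Fin l → ℂ) (f : FreeTop l →ₐ[ℂ⟦X⟧] B) (hf : ∀ x, IsRelator a d c x → f x = 0) :
    QAlg a d c →ₐ[ℂ⟦X⟧] B :=
  RingCon.liftₐ _ f fun {x y} h => by
    have h1 : x - y ∈ relIdeal a d c := (TwoSidedIdeal.rel_iff _ x y).mp h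
    have h2 := eq_zero_of_mem_relIdeal a d c f hf h1
    rw [map_sub, sub_eq_zero] at h2
    exact h2

variable [Algebra ℂ B]

theorem exists_hasHSum_lift [HAdic B] (g : Gen l → B) (x : FreeTop l) :
    ∃ s : B, HasHSum (fun k => FreeAlgebra.lift ℂ g (PowerSeries.coeff k x)) s :=
  HAdic.exists_hasHSum _

variable [IsScalarTower ℂ ℂ⟦X⟧ B]

/-- The restriction of a homomorphism to constant power series. -/
def restrictC (f : FreeTop l →ₐ[ℂ⟦X⟧] B) : FreeAlgebra ℂ (Gen l) →ₐ[ℂ] B :=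
  { f.toRingHom.comp (PowerSeries.C (R := FreeAlgebra ℂ (Gen l))) with
    commutes' := fun r => by
      have h : (PowerSeries.C (algebraMap ℂ (FreeAlgebra ℂ (Gen l)) r) : FreeTop l) =
          algebraMap ℂ (FreeTop l) r := by
        rw [PowerSeries.algebraMap_apply]
      change f (PowerSeries.C (algebraMap ℂ (FreeAlgebra ℂ (Gen l)) r)) = _
      rw [h]
      exact (f.restrictScalars ℂ).commutes r }

theorem restrictC_apply (f : FreeTop l →ₐ[ℂ⟦X⟧] B) (x : FreeAlgebra ℂ (Gen l)) :
    restrictC f x = f (PowerSeries.C x) := rfl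

theorem freeTop_hom_ext [HAdic B] {f g : FreeTop l →ₐ[ℂ⟦X⟧] B} (h : ∀ s, f (gen s) = g (gen s)) :
    f = g := by
  have h1 : restrictC f = restrictC g := FreeAlgebra.hom_ext (funext h)
  exact AlgHom.ext fun x => freeTop_hom_congr fun k => DFunLike.congr_fun h1 _

variable [HAdic B]

/-- The homomorphism from the completed free algebra to a complete algebra with prescribed values
on the generators. -/
def liftFree (g : Gen l → B) : FreeTop l →ₐ[ℂ⟦X⟧] B where
  toFun x := (exists_hasHSum_lift g x).choose
  map_zero' := HasHSum.unique (exists_hasHSum_lift g 0).choose_spec <| by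
    simpa using hasHSum_single (0 : B)
  map_one' := HasHSum.unique (exists_hasHSum_lift g 1).choose_spec <| by
    simpa [PowerSeries.coeff_one, apply_ite] using hasHSum_single (1 : B)
  map_add' x y := HasHSum.unique (exists_hasHSum_lift g (x + y)).choose_spec <| by
    simpa using (exists_hasHSum_lift g x).choose_spec.add (exists_hasHSum_lift g y).choose_spec
  map_mul' x y := HasHSum.unique (exists_hasHSum_lift g (x * y)).choose_spec <| by
    simpa [PowerSeries.coeff_mul] using
      (exists_hasHSum_lift g x).choose_spec.mul (exists_hasHSum_lift g y).choose_spec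
  commutes' r := HasHSum.unique (exists_hasHSum_lift g (algebraMap _ _ r)).choose_spec <| by
    refine (HasHSum.map (hasHSum_C_coeff_complex r) (Algebra.linearMap ℂ⟦X⟧ B)).congr
      fun k => Eq.symm ?_
    have h : PowerSeries.coeff k (algebraMap ℂ⟦X⟧ (FreeTop l) r) =
        algebraMap ℂ _ (PowerSeries.coeff k r) := by
      change PowerSeries.coeff k (PowerSeries.map _ _) = _
      rw [PowerSeries.coeff_map]
    rw [h, AlgHom.commutes, Algebra.linearMap_apply, ← IsScalarTower.algebraMap_apply]

theorem liftFree_gen (g : Gen l → B) (s : Gen l) : liftFree g (gen s) = g s :=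
  HasHSum.unique (exists_hasHSum_lift g (gen s)).choose_spec <| by
    simpa [gen, PowerSeries.coeff_C, apply_ite] using hasHSum_single (g s)

variable {a : Matrix (Fin l) (Fin l) ℤ} {d : Fin l → ℕ} {c : Fin l → Fin l → ℂ}

theorem qAlg_hom_ext {f g : QAlg a d c →ₐ[ℂ⟦X⟧] B}
    (he : ∀ i, f (genE a d c i) = g (genE a d c i))
    (hf : ∀ i, f (genF a d c i) = g (genF a d c i))
    (hH : ∀ i, f (genH a d c i) = g (genH a d c i)) : f = g := by
  have h : f.comp (toQAlg a d c) = g.comp (toQAlg a d c) :=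
    freeTop_hom_ext fun s => by
      cases s with
      | e i => exact he i
      | f i => exact hf i
      | H i => exact hH i
  refine AlgHom.ext fun x => ?_
  obtain ⟨x, rfl⟩ := toQAlg_surjective a d c x
  exact DFunLike.congr_fun h x

end Lift

/-! ### The Cartan part and weight vectors -/

theorem qpow_natCast_mul (k : ℕ) (c : ℂ) : qpow c ^ k = qpow (k * c) := by
  induction k with
  | zero => simp [qpow_zero]
  | succ k ih => rw [pow_succ, ih, ← qpow_add]; congr 1; push_cast; ring

section QAlg

variable {l : ℕ} {a : Matrix (Fin l) (Fin l) ℤ} {d : Fin l → ℕ} {c : Fin l → Fin l → ℂ}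

theorem genH_mul_genH (i j : Fin l) : genH a d c i * genH a d c j = genH a d c j * genH a d c i :=
  sub_eq_zero.mp (by
    have h := toQAlg_relator a d c (.HH i j)
    rwa [map_sub, map_mul, map_mul] at h)

theorem genH_mul_genE (i j : Fin l) :
    genH a d c i * genE a d c j = genE a d c j * genH a d c i + (a i j : ℂ) • genE a d c j := by
  have h := toQAlg_relator a d c (.He i j)
  rw [map_sub, map_sub, map_zsmul, map_mul, map_mul, ← Int.cast_smul_eq_zsmul ℂ, sub_sub,
    sub_eq_zero] at h
  exact h

theorem genH_mul_genF (i j : Fin l) :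
    genH a d c i * genF a d c j = genF a d c j * genH a d c i + (-(a i j) : ℂ) • genF a d c j := by
  have h := toQAlg_relator a d c (.Hf i j)
  rw [map_add, map_sub, map_zsmul, map_mul, map_mul, ← Int.cast_smul_eq_zsmul ℂ,
    ← sub_neg_eq_add, sub_sub, sub_eq_zero, ← neg_smul] at h
  exact h

theorem genE_mul_genF (i j : Fin l) :
    genE a d c i * genF a d c j = qpow (-(c i j)) • (genF a d c j * genE a d c i) +
      if i = j then toQAlg a d c (cartanFrac d i) else 0 := by
  have h := toQAlg_relator a d c (.ef i j)
  rw [map_sub, map_sub, map_mul, map_smul, map_mul, sub_sub, sub_eq_zero, apply_ite (toQAlg a d c),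
    map_zero] at h
  exact h

variable (a d c) in
/-- `x` is a weight vector on which `ad H_i` acts by `μ i`. -/
def IsWt (μ : Fin l → ℂ) (x : QAlg a d c) : Prop :=
  ∀ i, genH a d c i * x = x * genH a d c i + μ i • x

theorem isWt_genE (j : Fin l) : IsWt a d c (fun i => a i j) (genE a d c j) :=
  fun i => genH_mul_genE i j

theorem isWt_genF (j : Fin l) : IsWt a d c (-(fun i => (a i j : ℂ))) (genF a d c j) :=
  fun i => genH_mul_genF i j

theorem IsWt.mul {μ ν : Fin l → ℂ} {x y : QAlg a d c} (hx : IsWt a d c μ x)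
    (hy : IsWt a d c ν y) : IsWt a d c (μ + ν) (x * y) := by
  intro i
  rw [← mul_assoc, hx i, add_mul, mul_assoc, hy i, Pi.add_apply, add_smul, mul_add, mul_smul_comm,
    smul_mul_assoc, mul_assoc]
  abel

theorem IsWt.sub {μ : Fin l → ℂ} {x y : QAlg a d c} (hx : IsWt a d c μ x)
    (hy : IsWt a d c μ y) : IsWt a d c μ (x - y) := by
  intro i
  rw [mul_sub, hx i, hy i, sub_mul, smul_sub]
  abel

theorem IsWt.smul {μ : Fin l → ℂ} {x : QAlg a d c} (hx : IsWt a d c μ x) (r : ℂ⟦X⟧) :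
    IsWt a d c μ (r • x) := by
  intro i
  rw [mul_smul_comm, hx i, smul_mul_assoc, smul_add, smul_comm r (μ i) x]

variable (a d c) in
/-- The element `∑ v_j H_j`. -/
def cartanVec (v : Fin l → ℂ) : QAlg a d c := ∑ j, v j • genH a d c j

theorem cartanVec_add (v w : Fin l → ℂ) :
    cartanVec a d c (v + w) = cartanVec a d c v + cartanVec a d c w := by
  simp only [cartanVec, Pi.add_apply, add_smul, Finset.sum_add_distrib]

theorem commute_genH_cartanVec (i : Fin l) (v : Fin l → ℂ) :
    Commute (genH a d c i) (cartanVec a d c v) :=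
  Commute.sum_right _ _ _ fun j _ => Commute.smul_right (genH_mul_genH i j) _

theorem commute_cartanVec (v w : Fin l → ℂ) :
    Commute (cartanVec a d c v) (cartanVec a d c w) :=
  Commute.sum_left _ _ _ fun i _ => Commute.smul_left (commute_genH_cartanVec i w) _

theorem IsWt.cartanVec_mul {μ : Fin l → ℂ} {x : QAlg a d c} (hx : IsWt a d c μ x)
    (v : Fin l → ℂ) :
    cartanVec a d c v * x = x * (cartanVec a d c v + algebraMap ℂ _ (v ⬝ᵥ μ)) := by
  simp only [cartanVec, Finset.sum_mul, mul_add, Finset.mul_sum, dotProduct]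
  rw [← Algebra.commutes, ← Algebra.smul_def, Finset.sum_smul, ← Finset.sum_add_distrib]
  refine Finset.sum_congr rfl fun i _ => ?_
  rw [smul_mul_assoc, hx i, smul_add, smul_smul, mul_smul_comm]

theorem toQAlg_C_cartanElt (v : Fin l → ℂ) :
    toQAlg a d c (PowerSeries.C (cartanElt v)) = cartanVec a d c v := by
  rw [← restrictC_apply, cartanElt, map_sum]
  refine Finset.sum_congr rfl fun j _ => ?_
  rw [map_smul]
  rfl

variable (a d c) in
theorem hasExp_expCartan (v : Fin l → ℂ) :
    HasExp (cartanVec a d c v) (expCartan a d c v) := by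
  rw [← toQAlg_C_cartanElt]
  exact (hasExp_expFree v).map (toQAlg a d c)

variable (a d c) in
theorem expCartan_add (v w : Fin l → ℂ) :
    expCartan a d c (v + w) = expCartan a d c v * expCartan a d c w := by
  refine (hasExp_expCartan a d c (v + w)).unique ?_
  rw [cartanVec_add]
  exact (hasExp_expCartan a d c v).mul (commute_cartanVec v w) (hasExp_expCartan a d c w)

variable (a d c) in
theorem expCartan_zero : expCartan a d c 0 = 1 := by
  refine (hasExp_expCartan a d c 0).unique ?_
  have h : cartanVec a d c 0 = algebraMap ℂ _ 0 := by simp [cartanVec]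
  rw [h, ← map_one (algebraMap ℂ⟦X⟧ (QAlg a d c)), ← qpow_zero]
  exact hasExp_algebraMap 0

theorem expCartan_mul_neg (v : Fin l → ℂ) :
    expCartan a d c v * expCartan a d c (-v) = 1 := by
  rw [← expCartan_add, add_neg_cancel, expCartan_zero]

theorem expCartan_neg_mul (v : Fin l → ℂ) :
    expCartan a d c (-v) * expCartan a d c v = 1 := by
  rw [← expCartan_add, neg_add_cancel, expCartan_zero]

theorem expCartan_comm (v w : Fin l → ℂ) :
    expCartan a d c v * expCartan a d c w = expCartan a d c w * expCartan a d c v := by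
  rw [← expCartan_add, ← expCartan_add, add_comm]

theorem expCartan_list_prod {m : ℕ} (v : Fin m → Fin l → ℂ) :
    (List.ofFn fun p => expCartan a d c (v p)).prod = expCartan a d c (∑ p, v p) := by
  induction m with
  | zero => simp [expCartan_zero]
  | succ m ih => rw [List.ofFn_succ, List.prod_cons, ih, Fin.sum_univ_succ, expCartan_add]

/-- `exp (h v) x = q^{μ(v)} x exp (h v)` for a vector `x` of weight `μ`. -/
theorem IsWt.expCartan_mul {μ : Fin l → ℂ} {x : QAlg a d c} (hx : IsWt a d c μ x)
    (v : Fin l → ℂ) :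
    expCartan a d c v * x = qpow (v ⬝ᵥ μ) • (x * expCartan a d c v) := by
  have h := (hasExp_expCartan a d c v).mul (Algebra.commutes (v ⬝ᵥ μ) _).symm
    (hasExp_algebraMap (v ⬝ᵥ μ))
  rw [(hasExp_expCartan a d c v).intertwine (hx.cartanVec_mul v) h, ← Algebra.commutes,
    ← Algebra.smul_def, mul_smul_comm]

theorem genH_comm_expCartan (i : Fin l) (v : Fin l → ℂ) :
    genH a d c i * expCartan a d c v = expCartan a d c v * genH a d c i :=
  ((hasExp_expCartan a d c v).intertwine (commute_genH_cartanVec i v).symm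
    (hasExp_expCartan a d c v)).symm

theorem isWt_expCartan (v : Fin l → ℂ) : IsWt a d c 0 (expCartan a d c v) := fun i => by
  rw [genH_comm_expCartan, Pi.zero_apply, zero_smul, add_zero]

/-- A homomorphism that fixes the `H_i` fixes the exponentials: homomorphisms of
`ℂ⟦h⟧`-algebras are automatically continuous. -/
theorem map_expCartan {c' : Fin l → Fin l → ℂ} (f : QAlg a d c →ₐ[ℂ⟦X⟧] QAlg a d c')
    (hf : ∀ i, f (genH a d c i) = genH a d c' i) (v : Fin l → ℂ) :
    f (expCartan a d c v) = expCartan a d c' v := by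
  refine HasExp.unique (u := cartanVec a d c' v) ?_ (hasExp_expCartan a d c' v)
  have h : f (cartanVec a d c v) = cartanVec a d c' v := by
    simp only [cartanVec, map_sum]
    exact Finset.sum_congr rfl fun j _ => by
      rw [← hf j]; exact map_smul (f.restrictScalars ℂ) _ _
  rw [← h]
  exact (hasExp_expCartan a d c v).map f

/-! ### Twisting the generators by Cartan exponentials -/

section Serre

variable {R A : Type*} [CommRing R] [Ring A] [Algebra R A] {E F T S : A} {u v w : R}

theorem pow_mul_of_qcomm {x y : A} (h : y * x = v • (x * y)) (k : ℕ) :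
    y ^ k * x = v ^ k • (x * y ^ k) := by
  induction k with
  | zero => simp
  | succ k ih =>
    rw [pow_succ', mul_assoc, ih, mul_smul_comm, ← mul_assoc, h, smul_mul_assoc, smul_smul,
      mul_assoc, pow_succ]

theorem mul_pow_of_qcomm_right {x y : A} (h : y * x = v • (x * y)) (k : ℕ) :
    y * x ^ k = v ^ k • (x ^ k * y) := by
  induction k with
  | zero => simp
  | succ k ih =>
    rw [pow_succ, ← mul_assoc, ih, smul_mul_assoc, mul_assoc, h, mul_smul_comm, smul_smul,
      mul_assoc, pow_succ]

theorem pow_mul_pow_of_qcomm {x y : A} (h : y * x = v • (x * y)) (k m : ℕ) :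
    y ^ k * x ^ m = v ^ (k * m) • (x ^ m * y ^ k) := by
  rw [pow_mul, mul_pow_of_qcomm_right (pow_mul_of_qcomm h k)]

/-- The power of `u` counts the pairs of a factor `T` and a factor `E` to its right. -/
theorem twisted_pow (hTE : T * E = u • (E * T)) (k : ℕ) :
    (E * T) ^ k = u ^ (k.choose 2) • (E ^ k * T ^ k) := by
  induction k with
  | zero => simp
  | succ k ih =>
    rw [pow_succ, ih, smul_mul_assoc, mul_assoc, ← mul_assoc (T ^ k), pow_mul_of_qcomm hTE,
      smul_mul_assoc, mul_smul_comm, smul_smul, ← pow_add, Nat.choose_succ_succ' k 1,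
      Nat.choose_one_right, add_comm k, pow_succ E, pow_succ T]
    simp only [mul_assoc]

/-- Moving all the Cartan factors of a twisted Serre monomial to the right. -/
theorem twisted_monomial (hTE : T * E = u • (E * T)) (hTF : T * F = v • (F * T))
    (hSE : S * E = w • (E * S)) (hTS : T * S = S * T) (p r : ℕ) :
    (E * T) ^ p * (F * S) * (E * T) ^ r =
      (u ^ ((p + r).choose 2) * v ^ p * w ^ r) • (E ^ p * F * E ^ r * (T ^ (p + r) * S)) := by
  have hchoose : (p + r).choose 2 = p.choose 2 + r.choose 2 + p * r := by
    have h := Nat.add_choose_eq p r 2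
    rw [h]
    simp [Finset.Nat.antidiagonal_succ]
    ring
  have hTS' : T ^ r * S = S * T ^ r := (Commute.pow_left (show Commute T S from hTS) r).eq
  calc (E * T) ^ p * (F * S) * (E * T) ^ r
      = (u ^ p.choose 2 * u ^ r.choose 2) •
          (E ^ p * (T ^ p * F) * (S * E ^ r) * T ^ r) := by
        rw [twisted_pow hTE, twisted_pow hTE, smul_mul_assoc, smul_mul_assoc,
          mul_smul_comm, smul_smul]
        simp only [mul_assoc]
    _ = (u ^ p.choose 2 * u ^ r.choose 2 * v ^ p * w ^ r) •
          (E ^ p * F * (T ^ p * E ^ r) * (S * T ^ r)) := by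
        rw [pow_mul_of_qcomm hTF, mul_pow_of_qcomm_right hSE]
        simp only [mul_smul_comm, smul_mul_assoc, smul_smul, mul_assoc]
        congr 1
        ring
    _ = _ := by
        rw [pow_mul_pow_of_qcomm hTE, ← hTS', hchoose, pow_add, pow_add, pow_add]
        simp only [mul_smul_comm, smul_mul_assoc, smul_smul, mul_assoc]
        congr 1
        ring

theorem sum_smul_pow_mul_smul (x y : A) (m : ℕ) (k : ℕ → R) :
    ∑ r ∈ Finset.range (m + 1), k r • ((u • x) ^ (m - r) * (v • y) * (u • x) ^ r) =
      (u ^ m * v) • ∑ r ∈ Finset.range (m + 1), k r • (x ^ (m - r) * y * x ^ r) := by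
  rw [Finset.smul_sum]
  refine Finset.sum_congr rfl fun r hr => ?_
  obtain ⟨s, rfl⟩ := Nat.exists_eq_add_of_le (Nat.lt_succ_iff.mp (Finset.mem_range.mp hr))
  simp only [smul_pow, smul_mul_assoc, mul_smul_comm, smul_smul, Nat.add_sub_cancel_left]
  congr 1
  ring

end Serre

/-- Twisting by Cartan exponentials turns the `c`-twisted Serre sum into the `c'`-twisted one,
where `c - c' = y - z` for the exponents `y`, `z` of the commutation factors. -/
theorem twisted_serre_sum {A : Type*} [Ring A] [Algebra ℂ⟦X⟧ A] {E F T S : A} {u : ℂ⟦X⟧}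
    {c c' y z : ℂ} (hTE : T * E = u • (E * T)) (hTF : T * F = qpow y • (F * T))
    (hSE : S * E = qpow z • (E * S)) (hTS : T * S = S * T) (hc : c - c' = y - z)
    (m : ℕ) (k : ℕ → ℂ⟦X⟧) :
    ∑ r ∈ Finset.range (m + 1), ((-1) ^ r * qpow (r * c) * k r) •
        ((E * T) ^ (m - r) * (F * S) * (E * T) ^ r) =
      (u ^ m.choose 2 * qpow (m * y)) • ((∑ r ∈ Finset.range (m + 1),
        ((-1) ^ r * qpow (r * c') * k r) • (E ^ (m - r) * F * E ^ r)) * (T ^ m * S)) := by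
  rw [Finset.sum_mul, Finset.smul_sum]
  refine Finset.sum_congr rfl fun r hr => ?_
  have hr' : r ≤ m := Nat.lt_succ_iff.mp (Finset.mem_range.mp hr)
  rw [twisted_monomial hTE hTF hSE hTS, Nat.sub_add_cancel hr', smul_mul_assoc, smul_smul,
    smul_smul]
  congr 1
  have h : qpow (r * c) * (qpow y ^ (m - r) * qpow z ^ r) = qpow (m * y) * qpow (r * c') := by
    rw [qpow_natCast_mul, qpow_natCast_mul, ← qpow_add, ← qpow_add, ← qpow_add, Nat.cast_sub hr']
    congr 1
    linear_combination (r : ℂ) * hc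
  linear_combination (u ^ m.choose 2 * (-1) ^ r * k r) * h

variable (a d c) in
theorem serre_genE (i j : Fin l) (hij : i ≠ j) :
    ∑ r ∈ Finset.range ((1 - a i j).toNat + 1),
      ((-1) ^ r * qpow (r * c i j) * qBinom (d i) (1 - a i j).toNat r) •
        (genE a d c i ^ ((1 - a i j).toNat - r) * genE a d c j * genE a d c i ^ r) = 0 := by
  have h := toQAlg_relator a d c (.serre_e i j hij)
  simp only [map_sum, map_smul, map_mul, map_pow] at h
  exact h

variable (a d c) in
theorem serre_genF (i j : Fin l) (hij : i ≠ j) :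
    ∑ r ∈ Finset.range ((1 - a i j).toNat + 1),
      ((-1) ^ r * qpow (r * c i j) * qBinom (d i) (1 - a i j).toNat r) •
        (genF a d c i ^ ((1 - a i j).toNat - r) * genF a d c j * genF a d c i ^ r) = 0 := by
  have h := toQAlg_relator a d c (.serre_f i j hij)
  simp only [map_sum, map_smul, map_mul, map_pow] at h
  exact h

/-- The element `(K_i - K_i⁻¹) / (q_i - q_i⁻¹)` is a power series whose coefficients are polynomials
in `H_i`, so it is preserved by homomorphisms that preserve the `H_j`. The defining equation
multiplied by `q_i - q_i⁻¹` would give this only in a target without `h`-torsion. -/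
theorem map_cartanFrac (f : FreeTop l →ₐ[ℂ⟦X⟧] QAlg a d c)
    (hf : ∀ j, f (gen (.H j)) = genH a d c j) (i : Fin l) :
    f (cartanFrac d i) = toQAlg a d c (cartanFrac d i) := by
  have hC : ∀ v : Fin l → ℂ, f (PowerSeries.C (cartanElt v)) =
      toQAlg a d c (PowerSeries.C (cartanElt v)) := fun v => by
    rw [toQAlg_C_cartanElt, ← restrictC_apply, cartanElt, map_sum]
    exact Finset.sum_congr rfl fun j _ => by rw [map_smul, ← hf j]; rfl
  rw [cartanFrac, map_smul, map_smul]
  congr 1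
  refine freeTop_hom_congr fun k => ?_
  rw [← restrictC_apply, ← restrictC_apply]
  simp only [divh, expFree, PowerSeries.coeff_mk, map_sub, map_smul, map_pow, restrictC_apply, hC]

/-- The images of the generators under the twist by Cartan exponentials:
`e_i ↦ e_i exp (h t_i)`, `f_i ↦ exp (-h t_i) f_i`, `H_i ↦ H_i`. -/
def twistGen (a : Matrix (Fin l) (Fin l) ℤ) (d : Fin l → ℕ) (c : Fin l → Fin l → ℂ)
    (t : Fin l → Fin l → ℂ) : Gen l → QAlg a d c
  | .e i => genE a d c i * expCartan a d c (t i)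
  | .f i => expCartan a d c (-(t i)) * genF a d c i
  | .H i => genH a d c i

/-- The twisted generators satisfy the relations of the algebra with parameter matrix `c`, provided
`c - c'` is the antisymmetrization of the matrix of the `α_j(t_i)`. -/
theorem liftFree_twistGen_relator {c' : Fin l → Fin l → ℂ} (t : Fin l → Fin l → ℂ)
    (y : Fin l → Fin l → ℂ) (hy : ∀ i j, t i ⬝ᵥ (fun k => (a k j : ℂ)) = y i j)
    (hc : ∀ i j, c i j - c' i j = y i j - y j i) (x : FreeTop l) (hx : IsRelator a d c x) :
    liftFree (twistGen a d c' t) x = 0 := by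
  have hE : ∀ i j, expCartan a d c' (t i) * genE a d c' j =
      qpow (y i j) • (genE a d c' j * expCartan a d c' (t i)) := fun i j => by
    rw [(isWt_genE j).expCartan_mul, hy]
  have hF : ∀ i j, expCartan a d c' (-(t i)) * genF a d c' j =
      qpow (y i j) • (genF a d c' j * expCartan a d c' (-(t i))) := fun i j => by
    rw [(isWt_genF j).expCartan_mul, neg_dotProduct_neg, hy]
  have hF' : ∀ i j, expCartan a d c' (t i) * genF a d c' j =
      qpow (-(y i j)) • (genF a d c' j * expCartan a d c' (t i)) := fun i j => by
    rw [(isWt_genF j).expCartan_mul, dotProduct_neg, hy]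
  have hE' : ∀ i j, expCartan a d c' (-(t i)) * genE a d c' j =
      qpow (-(y i j)) • (genE a d c' j * expCartan a d c' (-(t i))) := fun i j => by
    rw [(isWt_genE j).expCartan_mul, neg_dotProduct, hy]
  cases hx with
  | HH i j =>
    simp only [map_sub, map_mul, liftFree_gen, twistGen]
    exact sub_eq_zero.mpr (genH_mul_genH i j)
  | He i j =>
    simp only [map_sub, map_mul, map_zsmul, liftFree_gen, twistGen]
    have h := (isWt_genE j).mul (isWt_expCartan (a := a) (d := d) (c := c') (t j)) i
    rw [h, add_zero, Int.cast_smul_eq_zsmul]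
    abel
  | Hf i j =>
    simp only [map_sub, map_add, map_mul, map_zsmul, liftFree_gen, twistGen]
    have h := (isWt_expCartan (a := a) (d := d) (c := c') (-(t j))).mul (isWt_genF j) i
    rw [h, zero_add, Pi.neg_apply, neg_smul, Int.cast_smul_eq_zsmul]
    abel
  | ef i j =>
    have hfrac : liftFree (twistGen a d c' t) (cartanFrac d i) = toQAlg a d c' (cartanFrac d i) :=
      map_cartanFrac _ (fun j => liftFree_gen _ _) i
    simp only [map_sub, map_mul, map_smul, liftFree_gen, twistGen,
      apply_ite (liftFree (twistGen a d c' t)), hfrac, map_zero]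
    have h1 : genE a d c' i * expCartan a d c' (t i) *
          (expCartan a d c' (-(t j)) * genF a d c' j) =
        qpow (y j j - y i j) • (genE a d c' i * genF a d c' j *
          (expCartan a d c' (t i) * expCartan a d c' (-(t j)))) := by
      rw [hF, mul_smul_comm, mul_assoc, ← mul_assoc (expCartan a d c' (t i)), hF']
      simp only [mul_smul_comm, smul_mul_assoc, smul_smul, ← qpow_add, mul_assoc]
      rw [sub_eq_add_neg]
    have h2 : expCartan a d c' (-(t j)) * genF a d c' j *
          (genE a d c' i * expCartan a d c' (t i)) =
        qpow (y j j - y j i) • (genF a d c' j * genE a d c' i *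
          (expCartan a d c' (t i) * expCartan a d c' (-(t j)))) := by
      rw [hF, smul_mul_assoc, mul_assoc, ← mul_assoc (expCartan a d c' (-(t j))), hE',
        expCartan_comm (t i)]
      simp only [mul_smul_comm, smul_mul_assoc, smul_smul, ← qpow_add, mul_assoc]
      rw [sub_eq_add_neg]
    rw [h1, h2, genE_mul_genF i j, add_mul, smul_add, smul_smul, smul_mul_assoc, smul_smul,
      ← qpow_add, ← qpow_add]
    have h3 : y j j - y i j + -(c' i j) = -(c i j) + (y j j - y j i) := by
      linear_combination hc i j
    rw [h3]
    split_ifs with hij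
    · subst hij
      rw [expCartan_mul_neg, sub_self, qpow_zero, one_smul, mul_one, mul_one, add_sub_cancel_left,
        sub_self]
    · simp
  | serre_e i j hij =>
    simp only [map_sum, map_smul, map_mul, map_pow, liftFree_gen, twistGen]
    rw [twisted_serre_sum (hE i i) (hE i j) (hE j i) (expCartan_comm _ _) (hc i j),
      serre_genE a d c' i j hij, zero_mul, smul_zero]
  | serre_f i j hij =>
    simp only [map_sum, map_smul, map_mul, map_pow, liftFree_gen, twistGen]
    simp only [hF i i, hF j j]
    rw [sum_smul_pow_mul_smul, twisted_serre_sum (hF i i) (hF i j) (hF j i) (expCartan_comm _ _)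
      (hc i j), serre_genF a d c' i j hij, zero_mul, smul_zero, smul_zero]

/-- The homomorphism given on generators by `e_i ↦ e_i exp (h t_i)`, `f_i ↦ exp (-h t_i) f_i`,
`H_i ↦ H_i`. -/
def twist {c' : Fin l → Fin l → ℂ} (t y : Fin l → Fin l → ℂ)
    (hy : ∀ i j, t i ⬝ᵥ (fun k => (a k j : ℂ)) = y i j)
    (hc : ∀ i j, c i j - c' i j = y i j - y j i) : QAlg a d c →ₐ[ℂ⟦X⟧] QAlg a d c' :=
  liftQ a d c (liftFree (twistGen a d c' t)) (liftFree_twistGen_relator t y hy hc)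

section twist

variable {c' : Fin l → Fin l → ℂ} {t y : Fin l → Fin l → ℂ}
  (hy : ∀ i j, t i ⬝ᵥ (fun k => (a k j : ℂ)) = y i j)
  (hc : ∀ i j, c i j - c' i j = y i j - y j i)

theorem twist_genE (i : Fin l) :
    twist (d := d) t y hy hc (genE a d c i) = genE a d c' i * expCartan a d c' (t i) :=
  liftFree_gen (twistGen a d c' t) (.e i)

theorem twist_genF (i : Fin l) :
    twist (d := d) t y hy hc (genF a d c i) = expCartan a d c' (-(t i)) * genF a d c' i :=
  liftFree_gen (twistGen a d c' t) (.f i)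

theorem twist_genH (i : Fin l) : twist (d := d) t y hy hc (genH a d c i) = genH a d c' i :=
  liftFree_gen (twistGen a d c' t) (.H i)

/-- The twists by `t` and by `-t` are mutually inverse. -/
theorem twist_comp_twist_neg {t' y' : Fin l → Fin l → ℂ} (ht : t' = -t)
    (hy' : ∀ i j, t' i ⬝ᵥ (fun k => (a k j : ℂ)) = y' i j)
    (hc' : ∀ i j, c' i j - c i j = y' i j - y' j i) :
    (twist (d := d) t y hy hc).comp (twist t' y' hy' hc') = AlgHom.id _ _ := by
  subst ht
  refine qAlg_hom_ext (fun i => ?_) (fun i => ?_) fun i => ?_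
  · rw [AlgHom.comp_apply, twist_genE, map_mul, twist_genE, map_expCartan _ (twist_genH hy hc),
      mul_assoc, Pi.neg_apply, expCartan_mul_neg, mul_one]
    rfl
  · rw [AlgHom.comp_apply, twist_genF, map_mul, twist_genF, map_expCartan _ (twist_genH hy hc),
      ← mul_assoc, Pi.neg_apply, expCartan_neg_mul, one_mul]
    rfl
  · rw [AlgHom.comp_apply, twist_genH, twist_genH]
    rfl

/-- The twist as an isomorphism. -/
def twistEquiv : QAlg a d c ≃ₐ[ℂ⟦X⟧] QAlg a d c' :=
  have hy' : ∀ i j, (-t) i ⬝ᵥ (fun k => (a k j : ℂ)) = (-y) i j := fun i j => by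
    rw [Pi.neg_apply, neg_dotProduct, hy]; rfl
  have hc' : ∀ i j, c' i j - c i j = (-y) i j - (-y) j i := fun i j => by
    have := hc i j
    simp only [Pi.neg_apply]
    linear_combination -this
  AlgEquiv.ofAlgHom (twist t y hy hc) (twist (-t) (-y) hy' hc')
    (twist_comp_twist_neg hy hc rfl hy' hc')
    (twist_comp_twist_neg hy' hc' (neg_neg t).symm hy hc)

theorem twistEquiv_apply (x : QAlg a d c) :
    twistEquiv (d := d) hy hc x = twist t y hy hc x := rfl

end twist

end QAlg

/-! ### The Cayley transform of a Coxeter element -/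

section Roots

variable {ι M N : Type*} [AddCommGroup M] [Module ℂ M] [AddCommGroup N] [Module ℂ N]
  {P : RootPairing ι ℂ M N}

/-- For a product `s` of reflections in roots `r_0, …, r_{n-1}`, the vector `x - s x` is a
combination of the `r_k` whose coefficients solve a unitriangular system. -/
theorem exists_sub_reflection_prod_eq {n : ℕ} (r : Fin n → ι) (x : M) :
    ∃ t : Fin n → ℂ,
      x - (List.ofFn fun k => (P.reflection (r k)).toLinearMap).prod x =
        ∑ k, t k • P.root (r k) ∧
      ∀ k, P.coroot' (r k) x = t k + ∑ j, if k < j then t j * P.pairing (r j) (r k) else 0 := by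
  induction n with
  | zero => exact ⟨0, by simp, fun k => k.elim0⟩
  | succ n ih =>
    obtain ⟨t, ht, hk⟩ := ih (fun k => r k.succ)
    set y := (List.ofFn fun k : Fin n => (P.reflection (r k.succ)).toLinearMap).prod x with hy
    refine ⟨Fin.cons (P.coroot' (r 0) y) t, ?_, fun k => ?_⟩
    · rw [List.ofFn_succ, List.prod_cons, Module.End.mul_apply, ← hy, Fin.sum_univ_succ]
      simp only [Fin.cons_zero, Fin.cons_succ]
      rw [← ht, LinearEquiv.coe_coe, P.reflection_apply]
      abel
    · rw [Fin.sum_univ_succ]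
      refine Fin.cases ?_ (fun k => ?_) k
      · have h : y = x - ∑ k, t k • P.root (r k.succ) := by rw [← ht]; abel
        simp only [Fin.cons_zero, Fin.cons_succ, lt_irrefl, if_false, Fin.succ_pos, if_true]
        rw [h, map_sub, map_sum]
        simp [P.root_coroot'_eq_pairing]
      · simp only [Fin.cons_succ, Fin.not_lt_zero, if_false, Fin.succ_lt_succ_iff]
        rw [hk k, zero_add]

variable (b : P.Base) {l : ℕ} (α : Fin l ≃ b.support)

theorem simpleBasis_apply [P.IsRootSystem] (i : Fin l) :
    simpleBasis b α i = P.root (α i) := by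
  simp [simpleBasis]

variable [P.IsCrystallographic]

theorem cartanMat_cast (i j : Fin l) : (cartanMat b α i j : ℂ) = P.pairing (α j) (α i) :=
  P.algebraMap_pairingIn ℤ (α j) (α i)

variable [P.IsRootSystem]

theorem form_root (d : Fin l → ℕ) (x : M) (k : Fin l) :
    form b α d x (P.root (α k)) = ∑ j, (simpleBasis b α).repr x j * (d j * cartanMat b α j k) := by
  conv_lhs => rw [← (simpleBasis b α).sum_repr x]
  rw [map_sum, LinearMap.sum_apply]
  refine Finset.sum_congr rfl fun j _ => ?_
  have h : form b α d (simpleBasis b α j) (simpleBasis b α k) =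
      (d j : ℂ) * (cartanMat b α j k : ℂ) := by
    rw [← LinearMap.BilinForm.toMatrix_apply, form, LinearMap.BilinForm.toMatrix_toBilin,
      Matrix.of_apply]
  rw [map_smul, LinearMap.smul_apply, ← simpleBasis_apply, h, smul_eq_mul]

theorem form_apply_root {d : Fin l → ℕ} (hd : IsSymmetrizer b α d) (x : M) (k : Fin l) :
    form b α d x (P.root (α k)) = d k * P.coroot' (α k) x := by
  rw [form_root]
  conv_rhs => rw [← (simpleBasis b α).sum_repr x]
  rw [map_sum, Finset.mul_sum]
  refine Finset.sum_congr rfl fun j _ => ?_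
  have h : (d j : ℂ) * cartanMat b α j k = d k * cartanMat b α k j := by
    exact_mod_cast hd.2.2 j k
  rw [map_smul, simpleBasis_apply, h, cartanMat_cast, P.root_coroot'_eq_pairing, smul_eq_mul]
  ring

variable [Finite ι]

theorem isUnit_det_cartanMat : IsUnit ((cartanMat b α).map (Int.cast : ℤ → ℂ)).det := by
  classical
  have h1 : cartanMat b α = (b.cartanMatrix.submatrix α α).transpose := rfl
  have h2 : b.cartanMatrix.det ≠ 0 :=
    Matrix.nondegenerate_iff_det_ne_zero.mp b.cartanMatrix_nondegenerate
  have h3 : ((cartanMat b α).map (Int.cast : ℤ → ℂ)).det = ((cartanMat b α).det : ℂ) :=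
    ((Int.castRingHom ℂ).map_det _).symm
  rw [isUnit_iff_ne_zero, h3, h1, Matrix.det_transpose, Matrix.det_submatrix_equiv_self]
  exact_mod_cast h2

/-- A vector on which all simple coroots vanish is zero: the Cartan matrix is invertible. -/
theorem eq_zero_of_coroot'_eq_zero {x : M} (h : ∀ i, P.coroot' (α i) x = 0) : x = 0 := by
  have h1 : ((cartanMat b α).map (Int.cast : ℤ → ℂ)).mulVec ((simpleBasis b α).repr x) = 0 := by
    funext k
    have h2 := h k
    rw [← (simpleBasis b α).sum_repr x, map_sum] at h2
    rw [Pi.zero_apply, ← h2, Matrix.mulVec, dotProduct]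
    refine Finset.sum_congr rfl fun j _ => ?_
    rw [map_smul, simpleBasis_apply, Matrix.map_apply, cartanMat_cast, P.root_coroot'_eq_pairing,
      smul_eq_mul, mul_comm]
  have h2 := Matrix.eq_zero_of_mulVec_eq_zero (isUnit_det_cartanMat b α).ne_zero h1
  exact (simpleBasis b α).repr.map_eq_zero_iff.mp (DFunLike.coe_injective h2)

/-- If `s x = x`, the coefficients of `x - s x` vanish, hence so do all simple coroots on `x`. -/
theorem isUnit_one_sub_coxeter (π : Equiv.Perm (Fin l)) :
    IsUnit (1 - coxeter b α π) := by
  have : Module.Finite ℂ M := Module.Finite.of_basis (simpleBasis b α)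
  rw [LinearMap.isUnit_iff_ker_eq_bot, LinearMap.ker_eq_bot']
  intro x hx
  obtain ⟨t, ht, hk⟩ := exists_sub_reflection_prod_eq (P := P) (fun k => (α (π k) : ι)) x
  have h0 : ∑ k, t k • ((simpleBasis b α).reindex π.symm) k = 0 := by
    simp only [Module.Basis.reindex_apply, Equiv.symm_symm, simpleBasis_apply]
    rw [← ht]
    exact hx
  have h1 : ∀ k, t k = 0 :=
    Fintype.linearIndependent_iff.mp ((simpleBasis b α).reindex π.symm).linearIndependent t h0
  refine eq_zero_of_coroot'_eq_zero b α fun i => ?_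
  have h2 := hk (π.symm i)
  simp only [h1, zero_mul, ite_self, Finset.sum_const_zero, add_zero, Equiv.apply_symm_apply] at h2
  exact h2

/-- The matrix elements of the Cayley transform above the diagonal, in the order given by the
Coxeter element, are those of `-(·, ·)`. -/
theorem cayley_of_lt {d : Fin l → ℕ} (hd : IsSymmetrizer b α d) (π : Equiv.Perm (Fin l))
    {p q : Fin l} (hpq : p < q) :
    cayley b α d π (π p) (π q) = -form b α d (P.root (α (π p))) (P.root (α (π q))) := by
  set v := Ring.inverse (1 - coxeter b α π) (P.root (α (π p))) with hv
  have h1 : v - coxeter b α π v = P.root (α (π p)) := by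
    have h := LinearMap.congr_fun (Ring.mul_inverse_cancel _ (isUnit_one_sub_coxeter b α π))
      (P.root (α (π p)))
    exact h
  obtain ⟨t, ht, hk⟩ := exists_sub_reflection_prod_eq (P := P) (fun k => (α (π k) : ι)) v
  have h2 : t = Pi.single p 1 := by
    have hB : ∀ k, ((simpleBasis b α).reindex π.symm) k = P.root (α (π k)) := fun k => by
      simp [simpleBasis_apply]
    have h3 : ∑ k, t k • ((simpleBasis b α).reindex π.symm) k =
        ((simpleBasis b α).reindex π.symm) p := by
      simp only [hB]
      rw [← ht]
      exact h1
    have h4 := congrArg ((simpleBasis b α).reindex π.symm).equivFun h3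
    rw [← Module.Basis.equivFun_symm_apply, LinearEquiv.apply_symm_apply] at h4
    rw [h4]
    ext k
    simp [Pi.single_apply, Finsupp.single_apply, eq_comm]
  have h3 : P.coroot' (α (π q)) v = 0 := by
    rw [hk q, h2, Finset.sum_eq_zero]
    · simp [hpq.ne']
    · intro j _
      split_ifs with hj
      · rw [Pi.single_eq_of_ne (by rintro rfl; exact absurd hpq hj.not_gt), zero_mul]
      · rfl
  have h5 : ((1 + coxeter b α π) * Ring.inverse (1 - coxeter b α π)) (P.root (α (π p))) =
      (2 : ℂ) • v - P.root (α (π p)) := by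
    rw [Module.End.mul_apply, ← hv, LinearMap.add_apply, Module.End.one_apply, ← h1, two_smul]
    abel
  rw [cayley, h5, map_sub, map_smul, LinearMap.sub_apply, LinearMap.smul_apply,
    form_apply_root b α hd v, h3, mul_zero, smul_zero, zero_sub]

/-! ### The exponents of the Cartan factors -/

/-- The `Y_p` are dual to the simple roots up to the factors `d_p`. -/
theorem weightY_dotProduct (d : Fin l → ℕ) (p j : Fin l) :
    weightY (cartanMat b α) d p ⬝ᵥ (fun k => (cartanMat b α k j : ℂ)) =
      if p = j then (d p : ℂ) else 0 := by
  have h := congrFun (congrFun (Matrix.nonsing_inv_mul _ (isUnit_det_cartanMat b α)) p) j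
  simp only [Matrix.mul_apply, Matrix.map_apply, Matrix.one_apply] at h
  simp only [dotProduct, weightY, mul_assoc]
  rw [← Finset.mul_sum, h, mul_ite, mul_one, mul_zero]

theorem sum_smul_weightY_dotProduct (d : Fin l → ℕ) (n : Fin l → Fin l → ℂ) (i j : Fin l) :
    (∑ p, n i p • weightY (cartanMat b α) d p) ⬝ᵥ (fun k => (cartanMat b α k j : ℂ)) =
      d j * n i j := by
  simp only [sum_dotProduct, smul_dotProduct, weightY_dotProduct, smul_eq_mul, mul_ite, mul_zero,
    Finset.sum_ite_eq', Finset.mem_univ, if_true]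
  rw [mul_comm]

end Roots

/-! ### Root vectors and characters -/

section RootVectors

variable {l : ℕ} {a : Matrix (Fin l) (Fin l) ℤ} {d : Fin l → ℕ} {c : Fin l → Fin l → ℂ}

/-- The `q`-commutator defining a positive root vector, after multiplication by a Cartan
exponential, is a combination of the two products of the twisted factors. -/
theorem qcomm_mul_expCartan {μ ν v w : Fin l → ℂ} {x y : QAlg a d c} (hx : IsWt a d c μ x)
    (hy : IsWt a d c ν y) (s : ℂ) :
    (x * y - qpow s • (y * x)) * expCartan a d c (v + w) =
      qpow (-(v ⬝ᵥ ν)) • ((x * expCartan a d c v) * (y * expCartan a d c w)) -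
      qpow (s - w ⬝ᵥ μ) • ((y * expCartan a d c w) * (x * expCartan a d c v)) := by
  have h1 : (x * expCartan a d c v) * (y * expCartan a d c w) =
      qpow (v ⬝ᵥ ν) • (x * y * expCartan a d c (v + w)) := by
    rw [mul_assoc, ← mul_assoc (expCartan a d c v), hy.expCartan_mul, expCartan_add]
    simp only [smul_mul_assoc, mul_smul_comm, mul_assoc]
  have h2 : (y * expCartan a d c w) * (x * expCartan a d c v) =
      qpow (w ⬝ᵥ μ) • (y * x * expCartan a d c (v + w)) := by
    rw [mul_assoc, ← mul_assoc (expCartan a d c w), hx.expCartan_mul, add_comm, expCartan_add]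
    simp only [smul_mul_assoc, mul_smul_comm, mul_assoc]
  rw [h1, h2, smul_smul, smul_smul, ← qpow_add, ← qpow_add, neg_add_cancel, qpow_zero, one_smul,
    sub_add_cancel, sub_mul, smul_mul_assoc]

/-- The analogue of `qcomm_mul_expCartan` for negative root vectors. -/
theorem expCartan_neg_mul_qcomm {μ ν v w : Fin l → ℂ} {x y : QAlg a d c}
    (hx : IsWt a d c (-μ) x) (hy : IsWt a d c (-ν) y) (s : ℂ) :
    expCartan a d c (-(v + w)) * (y * x - qpow (-s) • (x * y)) =
      qpow (v ⬝ᵥ ν) • ((expCartan a d c (-w) * y) * (expCartan a d c (-v) * x)) -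
      qpow (-(s - w ⬝ᵥ μ)) • ((expCartan a d c (-v) * x) * (expCartan a d c (-w) * y)) := by
  have h1 : expCartan a d c (-(v + w)) * (y * x) =
      qpow (v ⬝ᵥ ν) • ((expCartan a d c (-w) * y) * (expCartan a d c (-v) * x)) := by
    rw [neg_add_rev, expCartan_add, mul_assoc, ← mul_assoc _ y x, hy.expCartan_mul,
      neg_dotProduct_neg]
    simp only [smul_mul_assoc, mul_smul_comm, mul_assoc]
  have h2 : expCartan a d c (-(v + w)) * (x * y) =
      qpow (w ⬝ᵥ μ) • ((expCartan a d c (-v) * x) * (expCartan a d c (-w) * y)) := by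
    rw [neg_add, expCartan_add, mul_assoc, ← mul_assoc _ x y, hx.expCartan_mul,
      neg_dotProduct_neg]
    simp only [smul_mul_assoc, mul_smul_comm, mul_assoc]
  rw [mul_sub, mul_smul_comm, h1, h2, smul_smul, ← qpow_add]
  congr 3
  ring

theorem map_smul_mul_sub {R A B : Type*} [CommRing R] [Ring A] [Algebra R A] [Ring B]
    [Algebra R B] (f : A ≃ₐ[R] B) (p r : R) (x y : A) :
    f (p • (x * y) - r • (y * x)) = p • (f x * f y) - r • (f y * f x) := by
  simp only [map_sub, map_smul, map_mul]

/-- A combination `p x y - r y x` is killed by every character that kills `x` or `y`, and by every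
character if `p = r`. -/
theorem character_smul_mul_sub {R A : Type*} [CommRing R] [Ring A] [Algebra R A]
    {S : Subalgebra R A} (χ : S →ₐ[R] R) {x y : A} (hx : x ∈ S) (hy : y ∈ S) (p r : R)
    (h : χ ⟨x, hx⟩ = 0 ∨ χ ⟨y, hy⟩ = 0 ∨ p = r) :
    ∃ hz : p • (x * y) - r • (y * x) ∈ S, χ ⟨_, hz⟩ = 0 := by
  refine ⟨S.sub_mem (S.smul_mem (S.mul_mem hx hy) p) (S.smul_mem (S.mul_mem hy hx) r), ?_⟩
  change χ (p • (⟨x, hx⟩ * ⟨y, hy⟩) - r • (⟨y, hy⟩ * ⟨x, hx⟩)) = 0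
  rw [map_sub, map_smul, map_smul, map_mul, map_mul]
  rcases h with h | h | h
  · rw [h]; simp
  · rw [h]; simp
  · rw [h, mul_comm (χ ⟨x, hx⟩), sub_self]

theorem opK_add (n : Fin l → Fin l → ℂ) (v w : Fin l → ℂ) :
    opK a d n (v + w) = opK a d n v + opK a d n w := by
  simp only [opK, Pi.add_apply, add_smul, Finset.sum_add_distrib]

theorem opK_single (n : Fin l → Fin l → ℂ) {i : Fin l} (hi : d i ≠ 0) :
    opK a d n (Pi.single i (d i : ℂ)) = ∑ p, n i p • weightY a d p := by
  have hi' : (d i : ℂ) ≠ 0 := Nat.cast_ne_zero.mpr hi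
  rw [opK, Finset.sum_eq_single i]
  · rw [Pi.single_eq_same, Finset.smul_sum]
    refine Finset.sum_congr rfl fun p _ => ?_
    rw [smul_smul, mul_div_cancel₀ _ hi']
  · intro j _ hj
    rw [Pi.single_eq_of_ne hj, zero_smul]
  · intro h
    exact absurd (Finset.mem_univ i) h

theorem prod_powL (z : Fin l → ℂ) :
    (List.ofFn fun p => powL a d p (z p)).prod =
      expCartan a d (fun _ _ => 0) (∑ p, z p • weightY a d p) :=
  expCartan_list_prod _

end RootVectors

section Roots

variable {ι M N : Type*} [AddCommGroup M] [Module ℂ M] [AddCommGroup N] [Module ℂ N]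
  {P : RootPairing ι ℂ M N} {b : P.Base} {l : ℕ} {α : Fin l ≃ b.support}

theorem PosRoot.height_toNat_lt {x y z : PosRoot b} (h : P.root z = P.root x + P.root y) :
    (b.height x).toNat < (b.height z).toNat ∧ (b.height y).toNat < (b.height z).toNat := by
  have h1 := b.height_add h
  have hx : 0 < b.height x := x.2
  have hy : 0 < b.height y := y.2
  omega

theorem PosRoot.eq_simpleRoot (α : Fin l ≃ b.support) {γ : PosRoot b} (h : (γ : ι) ∈ b.support) :
    ∃ i, γ = simpleRoot b α i :=
  ⟨α.symm ⟨γ, h⟩, Subtype.ext (by simp [simpleRoot])⟩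

variable (α) in
/-- The values of a root on the simple coroots. -/
def rootWt (γ : PosRoot b) : Fin l → ℂ := fun i => P.pairing γ (α i)

theorem rootWt_add {x y z : PosRoot b} (h : P.root z = P.root x + P.root y) :
    rootWt α z = rootWt α x + rootWt α y := by
  funext i
  simp only [rootWt, Pi.add_apply, ← P.root_coroot'_eq_pairing, h, map_add]

theorem rootWt_simpleRoot [P.IsCrystallographic] (j : Fin l) :
    rootWt α (simpleRoot b α j) = fun i => (cartanMat b α i j : ℂ) :=
  funext fun i => (cartanMat_cast b α i j).symm

variable [P.IsRootSystem]

theorem checkVec_add (d : Fin l → ℕ) {x y z : PosRoot b} (h : P.root z = P.root x + P.root y) :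
    checkVec b α d z = checkVec b α d x + checkVec b α d y := by
  funext i
  simp only [checkVec, Pi.add_apply, h, map_add, Finsupp.add_apply, add_mul]

theorem checkVec_simpleRoot (d : Fin l → ℕ) (i : Fin l) :
    checkVec b α d (simpleRoot b α i) = Pi.single i (d i : ℂ) := by
  funext j
  have h : P.root (simpleRoot b α i : PosRoot b) = simpleBasis b α i :=
    (simpleBasis_apply b α i).symm
  rw [checkVec, h, Module.Basis.repr_self]
  rcases eq_or_ne i j with rfl | hij
  · simp
  · simp [Finsupp.single_eq_of_ne hij.symm, Pi.single_eq_of_ne hij.symm]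

variable [P.IsCrystallographic] {d : Fin l → ℕ} {m : ℕ} {β : Fin m ≃ PosRoot b}
  {Xp Xm : PosRoot b → Uh (cartanMat b α) d}

theorem IsRootVectors.isWt (hX : IsRootVectors b α d β Xp Xm) (γ : PosRoot b) :
    IsWt _ d _ (rootWt α γ) (Xp γ) ∧ IsWt _ d _ (-rootWt α γ) (Xm γ) := by
  induction hk : (b.height γ).toNat using Nat.strong_induction_on generalizing γ with
  | _ k ih =>
    subst hk
    by_cases hγ : (γ : ι) ∈ b.support
    · obtain ⟨i, rfl⟩ := PosRoot.eq_simpleRoot α hγ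
      rw [(hX.1 i).1, (hX.1 i).2, rootWt_simpleRoot]
      exact ⟨isWt_genE i, isWt_genF i⟩
    · obtain ⟨x, y, hxy, -, -, hp, hm⟩ := hX.2 γ hγ
      obtain ⟨hx1, hx2⟩ := ih _ (PosRoot.height_toNat_lt hxy).1 x rfl
      obtain ⟨hy1, hy2⟩ := ih _ (PosRoot.height_toNat_lt hxy).2 y rfl
      rw [hp, hm, rootWt_add hxy]
      refine ⟨(hx1.mul hy1).sub (IsWt.smul ?_ _), IsWt.sub ?_ (IsWt.smul ?_ _)⟩
      · rw [add_comm]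
        exact hy1.mul hx1
      · rw [neg_add_rev]
        exact hy2.mul hx2
      · rw [neg_add]
        exact hx2.mul hy2

/-- The exponents of the two products in a `q`-commutator of twisted simple root vectors agree. -/
theorem simple_exponents [Finite ι] (hd : IsSymmetrizer b α d) (π : Equiv.Perm (Fin l))
    (n : Fin l → Fin l → ℂ)
    (hn : ∀ i j, (d j : ℂ) * n i j - (d i : ℂ) * n j i = cayley b α d π i j) {p q : Fin l}
    (hpq : p < q) :
    -(opK (cartanMat b α) d n (checkVec b α d (simpleRoot b α (π p))) ⬝ᵥ
        rootWt α (simpleRoot b α (π q))) =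
      form b α d (P.root (simpleRoot b α (π p) : PosRoot b))
          (P.root (simpleRoot b α (π q) : PosRoot b)) -
        opK (cartanMat b α) d n (checkVec b α d (simpleRoot b α (π q))) ⬝ᵥ
          rootWt α (simpleRoot b α (π p)) := by
  rw [checkVec_simpleRoot, checkVec_simpleRoot, opK_single n (hd.1 _).ne',
    opK_single n (hd.1 _).ne', rootWt_simpleRoot, rootWt_simpleRoot,
    sum_smul_weightY_dotProduct, sum_smul_weightY_dotProduct]
  have h := hn (π p) (π q)
  rw [cayley_of_lt b α hd π hpq] at h
  change _ = form b α d (P.root (α (π p))) (P.root (α (π q))) - _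
  linear_combination -h

variable {c : Fin l → Fin l → ℂ}

theorem IsCoxeterIso.symm_simple (hd : IsSymmetrizer b α d) (hX : IsRootVectors b α d β Xp Xm)
    {n : Fin l → Fin l → ℂ} {ψ : QAlg (cartanMat b α) d c ≃ₐ[ℂ⟦X⟧] Uh (cartanMat b α) d}
    (hψ : IsCoxeterIso _ d _ n ψ) (i : Fin l) :
    ψ.symm (Xp (simpleRoot b α i) * expCartan _ d _
        (opK (cartanMat b α) d n (checkVec b α d (simpleRoot b α i)))) = genE _ d c i ∧
      ψ.symm (expCartan _ d _
        (-(opK (cartanMat b α) d n (checkVec b α d (simpleRoot b α i)))) *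
          Xm (simpleRoot b α i)) = genF _ d c i := by
  rw [AlgEquiv.symm_apply_eq, AlgEquiv.symm_apply_eq, (hψ i).1, (hψ i).2.1, prod_powL, prod_powL,
    checkVec_simpleRoot, opK_single n (hd.1 i).ne', (hX.1 i).1, (hX.1 i).2]
  simp only [neg_smul, Finset.sum_neg_distrib, and_self]

/-- The twist by the exponentials of the vectors `∑_p n_{ip} Y_p`. -/
theorem exists_isCoxeterIso [Finite ι] (n : Fin l → Fin l → ℂ)
    (hn : ∀ i j, (d j : ℂ) * n i j - (d i : ℂ) * n j i = c i j) :
    ∃ ψ : QAlg (cartanMat b α) d c ≃ₐ[ℂ⟦X⟧] Uh (cartanMat b α) d, IsCoxeterIso _ d _ n ψ := by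
  refine ⟨twistEquiv (t := fun i => ∑ p, n i p • weightY (cartanMat b α) d p)
    (y := fun i j => d j * n i j) (sum_smul_weightY_dotProduct b α d n)
    (fun i j => by rw [← hn i j, sub_zero]), fun i => ⟨?_, ?_, ?_⟩⟩
  · rw [twistEquiv_apply, twist_genE, prod_powL]
  · rw [twistEquiv_apply, twist_genF, prod_powL]
    simp only [neg_smul, Finset.sum_neg_distrib]
  · rw [twistEquiv_apply, twist_genH]

/-- The twisted root vectors lie in the nilpotent subalgebras, and characters vanish on those
attached to non-simple roots. -/
theorem twisted_rootVector_mem_and_character_eq_zero [Finite ι] (hd : IsSymmetrizer b α d)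
    (π : Equiv.Perm (Fin l)) (n : Fin l → Fin l → ℂ)
    (hn : ∀ i j, (d j : ℂ) * n i j - (d i : ℂ) * n j i = cayley b α d π i j)
    (hπ : ∀ i j : Fin l, i < j →
      β.symm (simpleRoot b α (π i)) < β.symm (simpleRoot b α (π j)))
    (hX : IsRootVectors b α d β Xp Xm)
    (χ : nPlus (cartanMat b α) d c →ₐ[ℂ⟦X⟧] ℂ⟦X⟧)
    (χ' : nMinus (cartanMat b α) d c →ₐ[ℂ⟦X⟧] ℂ⟦X⟧)
    (ψ : QAlg (cartanMat b α) d c ≃ₐ[ℂ⟦X⟧] Uh (cartanMat b α) d)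
    (hψ : IsCoxeterIso _ d _ n ψ) (γ : PosRoot b) :
    (∃ he : ψ.symm (Xp γ * expCartan _ d _ (opK (cartanMat b α) d n (checkVec b α d γ))) ∈
        nPlus (cartanMat b α) d c, γ.1 ∉ b.support → χ ⟨_, he⟩ = 0) ∧
      (∃ hf : ψ.symm (expCartan _ d _ (-(opK (cartanMat b α) d n (checkVec b α d γ))) * Xm γ) ∈
        nMinus (cartanMat b α) d c, γ.1 ∉ b.support → χ' ⟨_, hf⟩ = 0) := by
  induction hk : (b.height γ).toNat using Nat.strong_induction_on generalizing γ with
  | _ k ih =>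
    subst hk
    by_cases hγ : (γ : ι) ∈ b.support
    · obtain ⟨i, rfl⟩ := PosRoot.eq_simpleRoot α hγ
      obtain ⟨h1, h2⟩ := hψ.symm_simple hd hX i
      exact ⟨⟨h1 ▸ genE_mem _ d c i, fun h => absurd hγ h⟩,
        ⟨h2 ▸ genF_mem _ d c i, fun h => absurd hγ h⟩⟩
    · obtain ⟨x, y, hxy, hlt, -, hp, hm⟩ := hX.2 γ hγ
      obtain ⟨⟨hex, hx⟩, ⟨hfx, hx'⟩⟩ := ih _ (PosRoot.height_toNat_lt hxy).1 x rfl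
      obtain ⟨⟨hey, hy⟩, ⟨hfy, hy'⟩⟩ := ih _ (PosRoot.height_toNat_lt hxy).2 y rfl
      obtain ⟨hwx, hwx'⟩ := hX.isWt x
      obtain ⟨hwy, hwy'⟩ := hX.isWt y
      rw [hp, hm, checkVec_add d hxy, opK_add, qcomm_mul_expCartan hwx hwy,
        expCartan_neg_mul_qcomm hwx' hwy', map_smul_mul_sub, map_smul_mul_sub]
      -- If neither factor is killed, both are simple and the two exponents coincide.
      have key : x.1 ∈ b.support → y.1 ∈ b.support →
          -(opK (cartanMat b α) d n (checkVec b α d x) ⬝ᵥ rootWt α y) =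
            form b α d (P.root x) (P.root y) -
              opK (cartanMat b α) d n (checkVec b α d y) ⬝ᵥ rootWt α x := by
        intro hxs hys
        obtain ⟨i, rfl⟩ := PosRoot.eq_simpleRoot α hxs
        obtain ⟨j, rfl⟩ := PosRoot.eq_simpleRoot α hys
        obtain ⟨p, rfl⟩ := π.surjective i
        obtain ⟨q, rfl⟩ := π.surjective j
        refine simple_exponents hd π n hn (lt_of_not_ge fun hqp => ?_)
        rcases hqp.lt_or_eq with h | rfl
        · exact absurd hlt (hπ q p h).not_gt
        · exact absurd hlt (lt_irrefl _)
      constructor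
      · obtain ⟨hz, hz0⟩ := character_smul_mul_sub χ hex hey _ _ <| by
          by_cases hxs : x.1 ∈ b.support
          · by_cases hys : y.1 ∈ b.support
            · exact Or.inr (Or.inr (congrArg qpow (key hxs hys)))
            · exact Or.inr (Or.inl (hy hys))
          · exact Or.inl (hx hxs)
        exact ⟨hz, fun _ => hz0⟩
      · obtain ⟨hz, hz0⟩ := character_smul_mul_sub χ' hfy hfx _ _ <| by
          by_cases hxs : x.1 ∈ b.support
          · by_cases hys : y.1 ∈ b.support
            · exact Or.inr (Or.inr (congrArg qpow
                ((neg_eq_iff_eq_neg.mp (key hxs hys)))))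
            · exact Or.inl (hy' hys)
          · exact Or.inr (Or.inl (hx' hxs))
        exact ⟨hz, fun _ => hz0⟩

end Roots

end CoxeterQG

end

theorem mainTheorem10
    {𝔤 : Type*} [LieRing 𝔤] [LieAlgebra ℂ 𝔤] [FiniteDimensional ℂ 𝔤] [LieAlgebra.IsSimple ℂ 𝔤]
    (𝔥 : LieSubalgebra ℂ 𝔤) [𝔥.IsCartanSubalgebra]
    (b : (LieAlgebra.IsKilling.rootSystem 𝔥).Base)
    {l : ℕ} (α : Fin l ≃ b.support)
    (d : Fin l → ℕ) (hd : CoxeterQG.IsSymmetrizer b α d)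
    (π : Equiv.Perm (Fin l))
    (n : Fin l → Fin l → ℂ)
    (hn : ∀ i j, (d j : ℂ) * n i j - (d i : ℂ) * n j i = CoxeterQG.cayley b α d π i j)
    {m : ℕ} (β : Fin m ≃ CoxeterQG.PosRoot b) (hβ : CoxeterQG.IsNormalOrdering b β)
    (hπ : ∀ i j : Fin l, i < j →
      β.symm (CoxeterQG.simpleRoot b α (π i)) < β.symm (CoxeterQG.simpleRoot b α (π j)))
    (Xp Xm : CoxeterQG.PosRoot b → CoxeterQG.Uh (CoxeterQG.cartanMat b α) d)
    (hX : CoxeterQG.IsRootVectors b α d β Xp Xm)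
    (κ κ' : Fin l → PowerSeries ℂ) (hκ : ∀ i, κ i ≠ 0) (hκ' : ∀ i, κ' i ≠ 0)
    (χ : CoxeterQG.nPlus (CoxeterQG.cartanMat b α) d (CoxeterQG.cayley b α d π)
      →ₐ[PowerSeries ℂ] PowerSeries ℂ)
    (hχ : ∀ i, χ ⟨CoxeterQG.genE _ _ _ i, CoxeterQG.genE_mem _ _ _ i⟩ = κ i)
    (χ' : CoxeterQG.nMinus (CoxeterQG.cartanMat b α) d (CoxeterQG.cayley b α d π)
      →ₐ[PowerSeries ℂ] PowerSeries ℂ)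
    (hχ' : ∀ i, χ' ⟨CoxeterQG.genF _ _ _ i, CoxeterQG.genF_mem _ _ _ i⟩ = κ' i) :
    (∃ ψ : CoxeterQG.QAlg (CoxeterQG.cartanMat b α) d (CoxeterQG.cayley b α d π)
        ≃ₐ[PowerSeries ℂ] CoxeterQG.Uh (CoxeterQG.cartanMat b α) d,
      CoxeterQG.IsCoxeterIso _ d _ n ψ) ∧
    ∀ ψ : CoxeterQG.QAlg (CoxeterQG.cartanMat b α) d (CoxeterQG.cayley b α d π)
        ≃ₐ[PowerSeries ℂ] CoxeterQG.Uh (CoxeterQG.cartanMat b α) d,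
      CoxeterQG.IsCoxeterIso _ d _ n ψ →
      ∀ γ : CoxeterQG.PosRoot b, γ.1 ∉ b.support →
        (∃ he : ψ.symm (Xp γ * CoxeterQG.expCartan _ d _
              (CoxeterQG.opK (CoxeterQG.cartanMat b α) d n (CoxeterQG.checkVec b α d γ))) ∈
            CoxeterQG.nPlus (CoxeterQG.cartanMat b α) d (CoxeterQG.cayley b α d π),
          χ ⟨_, he⟩ = 0) ∧
        (∃ hf : ψ.symm (CoxeterQG.expCartan _ d _
              (-(CoxeterQG.opK (CoxeterQG.cartanMat b α) d n (CoxeterQG.checkVec b α d γ))) *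
                Xm γ) ∈
            CoxeterQG.nMinus (CoxeterQG.cartanMat b α) d (CoxeterQG.cayley b α d π),
          χ' ⟨_, hf⟩ = 0) := by
  refine ⟨CoxeterQG.exists_isCoxeterIso n hn, fun ψ hψ γ hγ => ?_⟩
  obtain ⟨⟨he, he0⟩, ⟨hf, hf0⟩⟩ :=
    CoxeterQG.twisted_rootVector_mem_and_character_eq_zero hd π n hn hπ hX χ χ' ψ hψ γ
  exact ⟨⟨he, he0 hγ⟩, ⟨hf, hf0 hγ⟩⟩
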